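/- There is an absolute constant $C>0$ such that the following holds. Let $m,n\ge 1$ be integers, let $\gamma\ge 4$ and $\beta\ge 1$ be real, and let $d$ be an integer with $1\le d\le n$. Let $M$ be an $m\times n$ random matrix with entries in $\{0,1\}$ whose rows are independent and each uniformly distributed on the set of all vectors in $\{0,1\}^n$ containing exactly $d$ ones. Put $k:=\lceil m/n\rceil$, let $\mathbb{E}M$ be the entrywise expectation of $M$, and let $\|\cdot\|$ be the operator norm from $\ell_2^n$ to $\ell_2^m$. Then, with probability at least $1-k\left(2^{\gamma}n^{1-\gamma}+2n^{-\beta}\right)$, $$\|M-\mathbb{E}M\|\le C\beta\sqrt{k}\,\sqrt{\min\{d,n-d\}+\gamma\log n}.$$ The bound is sharp up to a constant in the following sense. There is an absolute constant $c>0$ such that, if in addition $m\ge n$ and $\log n\le d\le n/2$, then almost surely $$\|M-\mathbb{E}M\|\ge \frac{c}{\sqrt{\gamma}}\sqrt{k}\,\sqrt{\min\{d,n-d\}+\gamma\log n}.$$ -/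

import Mathlib

open MeasureTheory ProbabilityTheory

open scoped Matrix.Norms.L2Operator

/-- The vectors of `{0,1}ⁿ` with exactly `d` ones, seen in `ℝⁿ`. -/
def zeroOneVectors (n d : ℕ) : Set (Fin n → ℝ) :=
  {v | (∀ j, v j = 0 ∨ v j = 1) ∧ {j | v j = 1}.ncard = d}

/-- `M` is a random `m × n` matrix whose rows are independent, each of them uniformly distributed
on the vectors of `{0,1}ⁿ` with exactly `d` ones. -/
structure IsRandomCombinatorialMatrix {Ω : Type*} [MeasurableSpace Ω] (P : Measure Ω)
    {m n : ℕ} (d : ℕ) (M : Ω → Matrix (Fin m) (Fin n) ℝ) : Prop where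
  row_law : ∀ i, HasLaw (fun ω => M ω i) (uniformOn (zeroOneVectors n d)) P
  row_indep : iIndepFun (fun i ω => M ω i) P

/-- The entrywise expectation `𝔼 M` of a random matrix. -/
noncomputable def expectedMatrix {Ω : Type*} [MeasurableSpace Ω] (P : Measure Ω)
    {m n : ℕ} (M : Ω → Matrix (Fin m) (Fin n) ℝ) : Matrix (Fin m) (Fin n) ℝ :=
  Matrix.of fun i j => ∫ ω, M ω i j ∂P

/-! For the upper bound, cut the rows into `k` blocks of at most `n` rows each; since squared norms
of row blocks add, the factor `√k` appears and it suffices to bound one block with high probability.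
There the argument is that of Kahn and Szemerédi, with `N = n`, `p = d / n`, `D = d + log n` and `r
= √D`.

The only probabilistic input is a comparison of exponential moments. For a uniform `d`-subset `S`,
the mean of `∏ l ∈ S, x l` is an elementary symmetric mean, so Maclaurin's inequality bounds it by
the `d`-th power of the arithmetic mean. Hence linear functionals of the matrix have exponential
moments no larger than those for independent Poisson entries of mean `p`
(`hasPoissonMGFBound_of_rows`), and Chernoff bounds apply despite the dependence inside a row.

The bilinear form is tested on two half-nets of the unit balls. Couples with `|u i * v j| ≤ r / N`
are light: an exponential tail of order `exp (-t N)` beats the size of the nets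
(`HasPoissonMGFBound.light_tail`). The remaining heavy couples are bounded deterministically by
`heavy_sum_le`, once row and column sums are `O(r ^ 2)` and no block contains too many ones. Rows
are automatic, columns and blocks follow from Chernoff and union bounds. Grouping coordinates
dyadically and bounding each pair of levels (`level_pair_bound`) leaves geometric series.

Passing to `1 - M` exchanges `d` with `n - d` and only changes the sign of the centred matrix, which
gives the minimum. The lower bound is deterministic: every row of the centred matrix has squared
length `d - d ^ 2 / n`, and the squared Hilbert–Schmidt norm is at most `n` times the squared
operator norm. -/

/-! ### Elementary symmetric means -/

section Maclaurin

variable {α : Type*} [Fintype α] [DecidableEq α]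

/-- Double counting of the pairs of a `k`-subset and an index outside it. -/
theorem sum_mul_sum_powersetCard_erase (x : α → ℝ) (k : ℕ) :
    ∑ j, x j * ∑ S ∈ Finset.powersetCard k (Finset.univ.erase j), ∏ l ∈ S, x l =
      (k + 1) * ∑ T ∈ Finset.powersetCard (k + 1) Finset.univ, ∏ l ∈ T, x l := by
  have h1 : ∀ j : α, x j * ∑ S ∈ Finset.powersetCard k (Finset.univ.erase j), ∏ l ∈ S, x l =
      ∑ T ∈ Finset.powersetCard (k + 1) Finset.univ with j ∈ T, ∏ l ∈ T, x l := by
    intro j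
    rw [Finset.mul_sum]
    refine Finset.sum_bij' (fun S _ => insert j S) (fun T _ => T.erase j) ?_ ?_ ?_ ?_ ?_
    · intro S hS
      simp only [Finset.mem_powersetCard, Finset.subset_erase] at hS
      simp [Finset.card_insert_of_notMem hS.1.2, hS.2]
    · intro T hT
      simp only [Finset.mem_filter, Finset.mem_powersetCard] at hT
      simp only [Finset.mem_powersetCard]
      exact ⟨Finset.erase_subset_erase _ hT.1.1, by rw [Finset.card_erase_of_mem hT.2]; omega⟩
    · intro S hS
      simp only [Finset.mem_powersetCard, Finset.subset_erase] at hS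
      exact Finset.erase_insert hS.1.2
    · intro T hT
      simp only [Finset.mem_filter] at hT
      exact Finset.insert_erase hT.2
    · intro S hS
      simp only [Finset.mem_powersetCard, Finset.subset_erase] at hS
      rw [Finset.prod_insert hS.1.2]
  simp_rw [h1, Finset.sum_filter]
  rw [Finset.sum_comm, Finset.mul_sum]
  refine Finset.sum_congr rfl fun T hT => ?_
  rw [← Finset.sum_filter, Finset.sum_const, Finset.filter_mem_eq_inter, Finset.univ_inter,
    (Finset.mem_powersetCard.1 hT).2]
  simp

theorem sum_sum_powersetCard_erase (x : α → ℝ) (k : ℕ) :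
    ∑ j, ∑ S ∈ Finset.powersetCard k (Finset.univ.erase j), ∏ l ∈ S, x l =
      ((Fintype.card α : ℝ) - k) * ∑ S ∈ Finset.powersetCard k Finset.univ, ∏ l ∈ S, x l := by
  have h1 : ∀ j : α, Finset.powersetCard k (Finset.univ.erase j) =
      (Finset.powersetCard k Finset.univ).filter (fun S => j ∉ S) := by
    intro j
    ext S
    simp [Finset.mem_powersetCard, Finset.subset_erase, and_comm]
  simp_rw [h1, Finset.sum_filter]
  rw [Finset.sum_comm, Finset.mul_sum]
  refine Finset.sum_congr rfl fun T hT => ?_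
  have hT' := (Finset.mem_powersetCard.1 hT).2
  rw [← Finset.sum_filter, Finset.sum_const, Finset.filter_notMem_eq_sdiff,
    ← Finset.compl_eq_univ_sdiff, Finset.card_compl, hT', nsmul_eq_mul,
    Nat.cast_sub (hT' ▸ Finset.card_le_univ T)]

/-- Transposing `i` and `j` matches the subsets avoiding `j` with those avoiding `i`, and only
replaces the factor `x i` by `x j`. Omitting the larger entry therefore leaves the smaller sum. -/
theorem antivary_sum_powersetCard_erase {x : α → ℝ} (hx : ∀ j, 0 ≤ x j) (k : ℕ) :
    Antivary x fun j => ∑ S ∈ Finset.powersetCard k (Finset.univ.erase j), ∏ l ∈ S, x l := by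
  intro i j hij
  by_contra! hlt
  refine absurd hij (not_lt.2 ?_)
  have hmap : Finset.univ.erase i = (Finset.univ.erase j).map (Equiv.swap i j).toEmbedding := by
    ext l
    simp only [Finset.mem_erase, Finset.mem_univ, and_true, Finset.mem_map_equiv, Equiv.symm_swap]
    rw [not_iff_not, Equiv.swap_apply_eq_iff, Equiv.swap_apply_right]
  simp only
  rw [hmap, Finset.powersetCard_map, Finset.sum_map]
  refine Finset.sum_le_sum fun S hS => ?_
  have hS' := (Finset.mem_powersetCard.1 hS).1
  simp only [Finset.mapEmbedding_apply, RelEmbedding.coe_toEmbedding, Finset.prod_map,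
    Equiv.coe_toEmbedding]
  refine Finset.prod_le_prod (fun l _ => hx l) fun l hl => ?_
  have hlj : l ≠ j := Finset.ne_of_mem_erase (hS' hl)
  by_cases hli : l = i
  · subst hli
    rw [Equiv.swap_apply_left]
    exact hlt.le
  · rw [Equiv.swap_apply_of_ne_of_ne hli hlj]

/-- **Maclaurin's inequality** comparing an elementary symmetric mean with the arithmetic mean. -/
theorem sum_powersetCard_prod_le [Nonempty α] {x : α → ℝ} (hx : ∀ j, 0 ≤ x j) (k : ℕ) :
    ∑ S ∈ Finset.powersetCard k Finset.univ, ∏ l ∈ S, x l ≤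
      (Fintype.card α).choose k * ((∑ j, x j) / Fintype.card α) ^ k := by
  have hn : (0 : ℝ) < Fintype.card α := by exact_mod_cast Fintype.card_pos
  have hs : 0 ≤ ∑ j, x j := Finset.sum_nonneg fun j _ => hx j
  induction k with
  | zero => simp
  | succ k ih =>
    -- Chebyshev's sum inequality; the two double counts turn it into a recursion between
    -- consecutive elementary symmetric sums.
    have h := (antivary_sum_powersetCard_erase hx k).card_mul_sum_le_sum_mul_sum
    rw [sum_mul_sum_powersetCard_erase, sum_sum_powersetCard_erase] at h
    rcases lt_or_ge k (Fintype.card α) with hk | hk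
    · have hc : ((Fintype.card α).choose (k + 1) : ℝ) * (k + 1) =
          (Fintype.card α).choose k * ((Fintype.card α : ℝ) - k) := by
        rw [← Nat.cast_sub hk.le]
        exact_mod_cast Nat.choose_succ_right_eq _ _
      have hk' : (0 : ℝ) ≤ (Fintype.card α : ℝ) - k := by
        rw [← Nat.cast_sub hk.le]; positivity
      have h2 := mul_le_mul_of_nonneg_left ih (mul_nonneg hs hk')
      refine le_of_mul_le_mul_left ?_ (show (0 : ℝ) < Fintype.card α * (k + 1) by positivity)
      calc (Fintype.card α : ℝ) * (k + 1) *
            ∑ S ∈ Finset.powersetCard (k + 1) Finset.univ, ∏ l ∈ S, x l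
          ≤ (∑ j, x j) * ((Fintype.card α : ℝ) - k) * ((Fintype.card α).choose k *
              ((∑ j, x j) / Fintype.card α) ^ k) := by linarith
        _ = ((Fintype.card α).choose k * ((Fintype.card α : ℝ) - k)) * ((∑ j, x j) *
              ((∑ j, x j) / Fintype.card α) ^ k) := by ring
        _ = _ := by
            rw [← hc, pow_succ]
            field_simp
    · rw [Finset.powersetCard_eq_empty.2 (by rw [Finset.card_univ]; omega), Finset.sum_empty]
      positivity

/-- Maclaurin followed by `1 + z ≤ exp z` applied to the arithmetic mean. With `x j = exp (b j)` the
right side becomes a Poisson exponential moment. -/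
theorem sum_powersetCard_prod_le_exp [Nonempty α] {x : α → ℝ} (hx : ∀ j, 0 ≤ x j) (k : ℕ) :
    ∑ S ∈ Finset.powersetCard k Finset.univ, ∏ l ∈ S, x l ≤
      (Fintype.card α).choose k * Real.exp (k / Fintype.card α * ∑ j, (x j - 1)) := by
  have hn : (0 : ℝ) < Fintype.card α := by exact_mod_cast Fintype.card_pos
  have hs : 0 ≤ ∑ j, x j := Finset.sum_nonneg fun j _ => hx j
  refine (sum_powersetCard_prod_le hx k).trans ?_
  refine mul_le_mul_of_nonneg_left ?_ (by positivity)
  have h : (∑ j, x j) / Fintype.card α ≤ Real.exp ((∑ j, (x j - 1)) / Fintype.card α) := by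
    have := Real.add_one_le_exp ((∑ j, (x j - 1)) / Fintype.card α)
    refine le_trans (le_of_eq ?_) this
    rw [Finset.sum_sub_distrib]
    simp only [Finset.sum_const, Finset.card_univ, nsmul_eq_mul]
    field_simp
    ring
  refine (pow_le_pow_left₀ (by positivity) h k).trans (le_of_eq ?_)
  rw [← Real.exp_nat_mul]
  congr 1
  ring

end Maclaurin

/-! ### The estimate for one pair of dyadic levels -/

section Dyadic

/-- The identity on `(-∞, 1]`, and zero above. -/
noncomputable def truncOne (z : ℝ) : ℝ := if z ≤ 1 then z else 0

theorem truncOne_of_le {z : ℝ} (h : z ≤ 1) : truncOne z = z := if_pos h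

theorem truncOne_nonneg {z : ℝ} (h : 0 ≤ z) : 0 ≤ truncOne z := by
  unfold truncOne; split_ifs <;> simp [h]

/-- The surviving terms are at most `1` and double with `t`, so from the largest one downwards they
are dominated by `1 + 1/2 + 1/4 + ⋯`. -/
theorem sum_truncOne_zpow_le (c : ℝ) (F : Finset ℤ) :
    ∑ t ∈ F, truncOne (c * (2 : ℝ) ^ t) ≤ 2 := by
  unfold truncOne
  rw [← Finset.sum_filter]
  set T := F.filter fun t => c * (2 : ℝ) ^ t ≤ 1 with hT
  rcases T.eq_empty_or_nonempty with h0 | hne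
  · simp [h0]
  · set t0 := T.max' hne
    have ht0 : c * (2 : ℝ) ^ t0 ≤ 1 := (Finset.mem_filter.1 (T.max'_mem hne)).2
    have hle : ∀ t ∈ T, t ≤ t0 := fun t ht => T.le_max' t ht
    calc ∑ t ∈ T, c * (2 : ℝ) ^ t ≤ ∑ t ∈ T, (1 / 2 : ℝ) ^ (t0 - t).toNat := by
          refine Finset.sum_le_sum fun t ht => ?_
          have h1 : (2 : ℝ) ^ t = 2 ^ t0 * (1 / 2 : ℝ) ^ (t0 - t).toNat := by
            rw [← zpow_natCast, Int.toNat_of_nonneg (by linarith [hle t ht]), one_div, inv_zpow,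
              ← zpow_neg, ← zpow_add₀ two_ne_zero]
            congr 1; ring
          rw [h1, ← mul_assoc]
          exact mul_le_of_le_one_left (by positivity) ht0
      _ = ∑ k ∈ T.image fun t => (t0 - t).toNat, (1 / 2 : ℝ) ^ k := by
          rw [Finset.sum_image]
          intro a ha b hb hab
          have := hle a ha
          have := hle b hb
          simp only at hab
          omega
      _ ≤ ∑' k : ℕ, (1 / 2 : ℝ) ^ k :=
          summable_geometric_two.sum_le_tsum _ fun _ _ => by positivity
      _ = 2 := tsum_geometric_two

theorem sum_truncOne_zpow_neg_le (c : ℝ) (F : Finset ℤ) :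
    ∑ t ∈ F, truncOne (c * (2 : ℝ) ^ (-t)) ≤ 2 := by
  have h := sum_truncOne_zpow_le c (F.map (Equiv.neg ℤ).toEmbedding)
  rwa [Finset.sum_map] at h

/-- The bounding kernel for one pair of dyadic levels. -/
noncomputable def levelKernel (r x y α β : ℝ) : ℝ :=
  α * β + α * truncOne (r * y / x) + β * truncOne (x / (r * y)) + α * truncOne (r / (x * y)) +
    β * truncOne (x / (2 * r))

theorem levelKernel_nonneg {r x y α β : ℝ} (hr : 0 < r) (hx : 0 < x) (hy : 0 < y) (hα : 0 ≤ α)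
    (hβ : 0 ≤ β) : 0 ≤ levelKernel r x y α β := by
  have h1 := truncOne_nonneg (show 0 ≤ r * y / x by positivity)
  have h2 := truncOne_nonneg (show 0 ≤ x / (r * y) by positivity)
  have h3 := truncOne_nonneg (show 0 ≤ r / (x * y) by positivity)
  have h4 := truncOne_nonneg (show 0 ≤ x / (2 * r) by positivity)
  unfold levelKernel
  positivity

theorem exp_half_le_two : Real.exp (1 / 2) ≤ 2 := by
  have h := Real.exp_one_lt_d9
  have h2 : Real.exp (1 / 2) * Real.exp (1 / 2) = Real.exp 1 := by
    rw [← Real.exp_add]; norm_num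
  nlinarith [Real.exp_pos (1 / 2)]

/-- The number `E` of ones in an `a × b` block with `a ≤ b` is either comparable with its mean, or
controlled by the entropy of the larger side. Here `r ^ 2` is the mean degree. -/
theorem level_pair_bound {N r κ x y a b E : ℝ} (hN : 0 < N) (hr : 0 < r) (hκ : 1 ≤ κ)
    (hx : 0 < x) (hy : 0 < y) (ha : 0 < a) (hb : 0 < b) (hbN : b ≤ N) (hE : 0 ≤ E)
    (hβ : y ^ 2 * b / N ≤ 4) (hxy : r ≤ x * y) (hdeg : E ≤ κ * r ^ 2 * a)
    (hdisc : E ≤ 8 * (r ^ 2 * a * b / N) ∨ (Real.exp 2 * (r ^ 2 * a * b / N) < E ∧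
      E * Real.log (E / (r ^ 2 * a * b / N)) ≤ κ * (b * (1 + Real.log (N / b))))) :
    x * y * E / N ≤ 8 * κ * r * levelKernel r x y (x ^ 2 * a / N) (y ^ 2 * b / N) := by
  set α := x ^ 2 * a / N with hα_def
  set β := y ^ 2 * b / N with hβ_def
  have hα : 0 < α := by positivity
  have hβ0 : 0 < β := by positivity
  have hκ0 : 0 < κ := by linarith
  set μ := r ^ 2 * a * b / N with hμ_def
  have hμ : 0 < μ := by positivity
  have k1 := truncOne_nonneg (show 0 ≤ r * y / x by positivity)
  have k2 := truncOne_nonneg (show 0 ≤ x / (r * y) by positivity)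
  have k3 := truncOne_nonneg (show 0 ≤ r / (x * y) by positivity)
  have k4 := truncOne_nonneg (show 0 ≤ x / (2 * r) by positivity)
  have reduce : ∀ T : ℝ, T ≤ levelKernel r x y α β → x * y * E / N ≤ 8 * κ * r * T →
      x * y * E / N ≤ 8 * κ * r * levelKernel r x y α β := fun T h1 h2 =>
    h2.trans (mul_le_mul_of_nonneg_left h1 (by positivity))
  have q0 : 0 ≤ α * β := by positivity
  have q1 : 0 ≤ α * truncOne (r * y / x) := by positivity
  have q2 : 0 ≤ β * truncOne (x / (r * y)) := by positivity
  have q3 : 0 ≤ α * truncOne (r / (x * y)) := by positivity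
  have q4 : 0 ≤ β * truncOne (x / (2 * r)) := by positivity
  have hmean : x * y * μ / N = r * (r / (x * y)) * (α * β) := by
    rw [hα_def, hβ_def, hμ_def]; field_simp
  clear_value α β μ
  have hq : r / (x * y) ≤ 1 := (div_le_one (by positivity)).2 hxy
  have hq0 : 0 < r / (x * y) := by positivity
  rcases hdisc with h8 | ⟨he2, hlog⟩
  · refine reduce (α * β) (by unfold levelKernel; linarith) ?_
    calc x * y * E / N ≤ x * y * (8 * μ) / N := by gcongr
      _ = 8 * r * (α * β) * (r / (x * y)) := by linear_combination 8 * hmean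
      _ ≤ 8 * r * (α * β) * 1 := by gcongr
      _ ≤ 8 * r * (α * β) * κ := by gcongr
      _ = _ := by ring
  set ρ := E / μ with hρ_def
  have hEρ : E = ρ * μ := by rw [hρ_def]; field_simp
  have hρ2 : Real.exp 2 < ρ := by rw [hρ_def, lt_div_iff₀ hμ]; exact he2
  clear_value ρ
  have hρ0 : 0 < ρ := (Real.exp_pos 2).trans hρ2
  have hlogρ : 2 < Real.log ρ := (Real.lt_log_iff_exp_lt hρ0).2 hρ2
  have hE' : x * y * E / N = r * (ρ * (r / (x * y))) * (α * β) := by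
    rw [hEρ]; linear_combination ρ * hmean
  by_cases hσ : ρ * (r / (x * y)) ≤ 1
  -- The excess over the mean is absorbed by the heaviness gain `r / (x * y)`.
  · refine reduce (α * β) (by unfold levelKernel; linarith) ?_
    rw [hE']
    calc r * (ρ * (r / (x * y))) * (α * β) ≤ r * 1 * (α * β) := by gcongr
      _ ≤ 8 * κ * (r * (α * β)) := by
          have : 0 ≤ r * (α * β) := by positivity
          linarith [mul_le_mul_of_nonneg_right hκ this]
      _ = _ := by ring
  push Not at hσ
  by_cases h2 : r * y ≤ x
  -- Very unbalanced levels: the degree bound alone is enough.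
  · refine reduce (α * truncOne (r * y / x)) (by unfold levelKernel; linarith) ?_
    rw [truncOne_of_le ((div_le_one hx).2 h2)]
    calc x * y * E / N ≤ x * y * (κ * r ^ 2 * a) / N := by gcongr
      _ = κ * r * (α * (r * y / x)) := by rw [hα_def]; field_simp
      _ ≤ 8 * (κ * r * (α * (r * y / x))) := by
          have : 0 ≤ κ * r * (α * (r * y / x)) := by positivity
          linarith
      _ = _ := by ring
  push Not at h2
  have hLb : 1 ≤ 1 + Real.log (N / b) :=
    le_add_of_nonneg_right (Real.log_nonneg ((one_le_div hb).2 hbN))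
  set Lb := 1 + Real.log (N / b) with hLb_def
  have hLb' : Lb = 1 + 2 * Real.log y - Real.log β := by
    rw [hLb_def, hβ_def, Real.log_div hN.ne' hb.ne', Real.log_div (by positivity) hN.ne',
      Real.log_mul (by positivity) hb.ne', Real.log_pow]
    push_cast; ring
  clear_value Lb
  -- If the logarithm of the excess is comparable with the entropy per element, both cancel in the
  -- discrepancy bound, leaving `E = O(κ * b)`. Otherwise `Lb` exceeds `4 * log ρ`, and the dominant
  -- part of `Lb` (from `y` or from `β`) decides.
  by_cases h3 : Lb ≤ 4 * Real.log ρ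
  · have hE4 : E ≤ 4 * κ * b := by
      have h6 : E * Lb ≤ E * (4 * Real.log ρ) := by gcongr
      have : E * Lb ≤ (4 * κ * b) * Lb := by linarith
      exact le_of_mul_le_mul_right this (by linarith)
    refine reduce (β * truncOne (x / (r * y))) (by unfold levelKernel; linarith) ?_
    rw [truncOne_of_le ((div_le_one (by positivity)).2 h2.le)]
    calc x * y * E / N ≤ x * y * (4 * κ * b) / N := by gcongr
      _ = 4 * (κ * r * (β * (x / (r * y)))) := by rw [hβ_def]; field_simp
      _ ≤ 8 * (κ * r * (β * (x / (r * y)))) := by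
          have : 0 ≤ κ * r * (β * (x / (r * y))) := by positivity
          linarith
      _ = _ := by ring
  push Not at h3
  by_cases h4 : -Real.log β ≤ 1 + 2 * Real.log y
  · have h5 : Real.log ρ ≤ 1 / 2 + Real.log y := by linarith
    have hρy : ρ ≤ 2 * y := by
      rw [Real.log_le_iff_le_exp hρ0, Real.exp_add, Real.exp_log hy] at h5
      exact h5.trans (by gcongr; exact exp_half_le_two)
    have hx2 : x ≤ 2 * r := by
      rw [← mul_div_assoc, lt_div_iff₀ (by positivity), one_mul] at hσ
      have h6 : ρ * r ≤ 2 * y * r := by gcongr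
      have : x * y ≤ (2 * r) * y := by linarith
      exact le_of_mul_le_mul_right this hy
    have hEb : E ≤ 2 * κ * b * y := by
      have hLy : Lb ≤ 4 * y := by
        have := Real.log_le_sub_one_of_pos hy
        have : 0 < y := hy
        linarith
      have h6 : E * 2 ≤ E * Real.log ρ := by gcongr
      have h7 : κ * (b * Lb) ≤ κ * (b * (4 * y)) := by gcongr
      linarith
    refine reduce (β * truncOne (x / (2 * r))) (by unfold levelKernel; linarith) ?_
    rw [truncOne_of_le ((div_le_one (by positivity)).2 hx2)]
    calc x * y * E / N ≤ x * y * (2 * κ * b * y) / N := by gcongr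
      _ = 4 * (κ * r * (β * (x / (2 * r)))) := by rw [hβ_def]; field_simp; ring
      _ ≤ 8 * (κ * r * (β * (x / (2 * r)))) := by
          have : 0 ≤ κ * r * (β * (x / (2 * r))) := by positivity
          linarith
      _ = _ := by ring
  · push Not at h4
    -- Here `Lb < -2 * log β`, so `log ρ < -(log β) / 2`; together with `β ≤ 4` this bounds `ρ * β`.
    have h5 : Real.log (ρ ^ 2 * β) ≤ 0 := by
      rw [Real.log_mul (by positivity) hβ0.ne', Real.log_pow]
      push_cast
      linarith
    have h6 : ρ ^ 2 * β ≤ 1 := by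
      rwa [Real.log_nonpos_iff (by positivity)] at h5
    have h7 : ρ * β ≤ 2 := by
      have : (ρ * β) ^ 2 ≤ 2 ^ 2 := by
        calc (ρ * β) ^ 2 = (ρ ^ 2 * β) * β := by ring
          _ ≤ 1 * 4 := by gcongr
          _ = 2 ^ 2 := by norm_num
      exact le_of_sq_le_sq this (by norm_num)
    refine reduce (α * truncOne (r / (x * y))) (by unfold levelKernel; linarith) ?_
    rw [truncOne_of_le hq, hE']
    calc r * (ρ * (r / (x * y))) * (α * β) = (ρ * β) * (r * (α * (r / (x * y)))) := by ring
      _ ≤ 2 * (r * (α * (r / (x * y)))) := by gcongr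
      _ ≤ 8 * κ * (r * (α * (r / (x * y)))) := by
          have : 0 ≤ r * (α * (r / (x * y))) := by positivity
          linarith [mul_le_mul_of_nonneg_right hκ this]
      _ = _ := by ring

end Dyadic

/-! ### Heavy couples -/

section Heavy

/-- In each truncated term the truncation is geometric in the index that its weight does not
involve. Summing that index first gives at most `2`, then the weight gives `4`; the total is `16 + 4
* 8`. -/
theorem sum_levelKernel_le (r : ℝ) (F G : Finset ℤ) {α β : ℤ → ℝ} (hα : ∀ s, 0 ≤ α s)
    (hβ : ∀ t, 0 ≤ β t) (hαs : ∑ s ∈ F, α s ≤ 4) (hβs : ∑ t ∈ G, β t ≤ 4) :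
    ∑ s ∈ F, ∑ t ∈ G, levelKernel r (2 ^ s) (2 ^ t) (α s) (β t) ≤ 48 := by
  have hA : ∀ f : ℤ → ℤ → ℝ, (∀ s, ∑ t ∈ G, f s t ≤ 2) →
      ∑ s ∈ F, ∑ t ∈ G, α s * f s t ≤ 8 := by
    intro f hf
    calc ∑ s ∈ F, ∑ t ∈ G, α s * f s t = ∑ s ∈ F, α s * ∑ t ∈ G, f s t := by
          simp_rw [Finset.mul_sum]
      _ ≤ ∑ s ∈ F, α s * 2 :=
          Finset.sum_le_sum fun s _ => mul_le_mul_of_nonneg_left (hf s) (hα s)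
      _ = (∑ s ∈ F, α s) * 2 := by rw [Finset.sum_mul]
      _ ≤ 8 := by linarith
  have hB : ∀ f : ℤ → ℤ → ℝ, (∀ t, ∑ s ∈ F, f s t ≤ 2) →
      ∑ s ∈ F, ∑ t ∈ G, β t * f s t ≤ 8 := by
    intro f hf
    rw [Finset.sum_comm]
    calc ∑ t ∈ G, ∑ s ∈ F, β t * f s t = ∑ t ∈ G, β t * ∑ s ∈ F, f s t := by
          simp_rw [Finset.mul_sum]
      _ ≤ ∑ t ∈ G, β t * 2 :=
          Finset.sum_le_sum fun t _ => mul_le_mul_of_nonneg_left (hf t) (hβ t)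
      _ = (∑ t ∈ G, β t) * 2 := by rw [Finset.sum_mul]
      _ ≤ 8 := by linarith
  have h0 : ∑ s ∈ F, ∑ t ∈ G, α s * β t ≤ 16 := by
    rw [← Finset.sum_mul_sum]
    have := Finset.sum_nonneg fun t (_ : t ∈ G) => hβ t
    calc _ ≤ (4 : ℝ) * 4 := by gcongr
      _ = 16 := by norm_num
  have h1 := hA (fun s t => truncOne (r * 2 ^ t / 2 ^ s)) fun s => by
    refine le_trans (le_of_eq ?_) (sum_truncOne_zpow_le (r / 2 ^ s) G)
    exact Finset.sum_congr rfl fun t _ => by rw [div_mul_eq_mul_div]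
  have h2 := hB (fun s t => truncOne (2 ^ s / (r * 2 ^ t))) fun t => by
    refine le_trans (le_of_eq ?_) (sum_truncOne_zpow_le (1 / (r * 2 ^ t)) F)
    exact Finset.sum_congr rfl fun t _ => by rw [one_div_mul_eq_div]
  have h3 := hA (fun s t => truncOne (r / (2 ^ s * 2 ^ t))) fun s => by
    refine le_trans (le_of_eq ?_) (sum_truncOne_zpow_neg_le (r / 2 ^ s) G)
    exact Finset.sum_congr rfl fun t _ => by rw [zpow_neg, ← div_div, ← div_eq_mul_inv]
  have h4 := hB (fun s _ => truncOne (2 ^ s / (2 * r))) fun t => by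
    refine le_trans (le_of_eq ?_) (sum_truncOne_zpow_le (1 / (2 * r)) F)
    exact Finset.sum_congr rfl fun t _ => by rw [one_div_mul_eq_div]
  unfold levelKernel
  simp only [Finset.sum_add_distrib]
  linarith

variable {ι η : Type*} [Fintype ι] [Fintype η]

/-- The indices at which `u * w` is positive, of dyadic size `2 ^ s`. -/
noncomputable def dyadicLevel (w : ℝ) (u : ι → ℝ) (s : ℤ) : Finset ι :=
  Finset.univ.filter fun i => 0 < u i ∧ Int.log 2 (u i * w) + 1 = s

/-- The sizes that occur in `u * w`. -/
noncomputable def dyadicRange (w : ℝ) (u : ι → ℝ) : Finset ℤ :=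
  (Finset.univ.filter fun i => 0 < u i).image fun i => Int.log 2 (u i * w) + 1

theorem lt_of_mem_dyadicLevel {w : ℝ} {u : ι → ℝ} {s : ℤ} {i : ι}
    (hi : i ∈ dyadicLevel w u s) : 0 < u i ∧ u i * w < 2 ^ s := by
  obtain ⟨h0, h1⟩ := (Finset.mem_filter.1 hi).2
  refine ⟨h0, ?_⟩
  have := Int.lt_zpow_succ_log_self (b := 2) (by norm_num) (u i * w)
  rw [h1] at this
  exact_mod_cast this

theorem le_of_mem_dyadicLevel {w : ℝ} (hw : 0 < w) {u : ι → ℝ} {s : ℤ} {i : ι}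
    (hi : i ∈ dyadicLevel w u s) : (2 : ℝ) ^ s ≤ 2 * (u i * w) := by
  obtain ⟨h0, h1⟩ := (Finset.mem_filter.1 hi).2
  have := Int.zpow_log_le_self (b := 2) (by norm_num) (mul_pos h0 hw)
  rw [← h1, zpow_add_one₀ two_ne_zero, mul_comm]
  push_cast at this
  linarith

theorem sum_dyadicLevel {w : ℝ} {u : ι → ℝ} (f : ι → ℝ) :
    ∑ s ∈ dyadicRange w u, ∑ i ∈ dyadicLevel w u s, f i =
      ∑ i with 0 < u i, f i := by
  rw [← Finset.sum_fiberwise_of_maps_to (s := Finset.univ.filter fun i => 0 < u i)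
    (t := dyadicRange w u) (g := fun i => Int.log 2 (u i * w) + 1)
    (fun i hi => Finset.mem_image_of_mem _ hi)]
  refine Finset.sum_congr rfl fun s _ => Finset.sum_congr ?_ fun _ _ => rfl
  rw [dyadicLevel, Finset.filter_filter]

theorem sq_mul_card_dyadicLevel_le {w : ℝ} (hw : 0 < w) (u : ι → ℝ) (s : ℤ) :
    ((2 : ℝ) ^ s) ^ 2 * (dyadicLevel w u s).card / w ^ 2 ≤ ∑ i ∈ dyadicLevel w u s, 4 * u i ^ 2 := by
  rw [div_le_iff₀ (by positivity), Finset.sum_mul, mul_comm, ← nsmul_eq_mul]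
  refine Finset.card_nsmul_le_sum _ _ _ fun i hi => ?_
  have h := pow_le_pow_left₀ (by positivity) (le_of_mem_dyadicLevel hw hi) 2
  linarith [show (2 * (u i * w)) ^ 2 = 4 * u i ^ 2 * w ^ 2 by ring]

theorem sum_sq_mul_card_dyadicLevel_le {w : ℝ} (hw : 0 < w) {u : ι → ℝ} (hu : ∑ i, u i ^ 2 ≤ 1) :
    ∑ s ∈ dyadicRange w u, ((2 : ℝ) ^ s) ^ 2 * (dyadicLevel w u s).card / w ^ 2 ≤ 4 := by
  refine (Finset.sum_le_sum fun s _ => sq_mul_card_dyadicLevel_le hw u s).trans ?_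
  rw [sum_dyadicLevel fun i => 4 * u i ^ 2]
  calc ∑ i with 0 < u i, 4 * u i ^ 2 ≤ ∑ i, 4 * u i ^ 2 :=
        Finset.sum_le_sum_of_subset_of_nonneg (Finset.filter_subset _ _) fun i _ _ => by positivity
    _ ≤ 4 := by rw [← Finset.mul_sum]; linarith

theorem sq_mul_card_dyadicLevel_le_four {w : ℝ} (hw : 0 < w) {u : ι → ℝ} (hu : ∑ i, u i ^ 2 ≤ 1)
    (s : ℤ) : ((2 : ℝ) ^ s) ^ 2 * (dyadicLevel w u s).card / w ^ 2 ≤ 4 := by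
  refine (sq_mul_card_dyadicLevel_le hw u s).trans ?_
  calc ∑ i ∈ dyadicLevel w u s, 4 * u i ^ 2 ≤ ∑ i, 4 * u i ^ 2 :=
        Finset.sum_le_sum_of_subset_of_nonneg (Finset.subset_univ _) fun i _ _ => by positivity
    _ ≤ 4 := by rw [← Finset.mul_sum]; linarith

/-- The discrepancy property: every block either has at most `exp 2` times the number of ones
expected at mean degree `r ^ 2`, or is controlled by the entropy of its larger side. -/
def HasDiscrepancyBound (N r κ : ℝ) (M : ι → η → ℝ) : Prop :=
  ∀ (A : Finset ι) (B : Finset η), A.Nonempty → B.Nonempty →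
    Real.exp 2 * (r ^ 2 * A.card * B.card / N) < ∑ i ∈ A, ∑ j ∈ B, M i j →
    (∑ i ∈ A, ∑ j ∈ B, M i j) *
        Real.log ((∑ i ∈ A, ∑ j ∈ B, M i j) / (r ^ 2 * A.card * B.card / N)) ≤
      κ * (max (A.card : ℝ) B.card * (1 + Real.log (N / max (A.card : ℝ) B.card)))

theorem HasDiscrepancyBound.transpose {ι η : Type*} {N r κ : ℝ} {M : ι → η → ℝ}
    (h : HasDiscrepancyBound N r κ M) : HasDiscrepancyBound N r κ fun j i => M i j := by
  intro B A hB hA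
  have := h A B hA hB
  rwa [Finset.sum_comm, mul_right_comm (r ^ 2), max_comm] at this

theorem exp_two_le_eight : Real.exp 2 ≤ 8 := by
  have h := Real.exp_one_lt_d9
  have h2 : Real.exp 2 = Real.exp 1 * Real.exp 1 := by rw [← Real.exp_add]; norm_num
  rw [h2]
  nlinarith [Real.exp_pos 1]

theorem block_bound_of_card_le {ι η : Type*} [Fintype η] {N r κ x y : ℝ} (hN : 0 < N) (hr : 0 < r) (hκ : 1 ≤ κ) (hx : 0 < x)
    (hy : 0 < y) {M : ι → η → ℝ} (hM : ∀ i j, 0 ≤ M i j) (hη : (Fintype.card η : ℝ) ≤ N)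
    (hrow : ∀ i, ∑ j, M i j ≤ κ * r ^ 2) (hdisc : HasDiscrepancyBound N r κ M)
    {A : Finset ι} {B : Finset η} (hA : A.Nonempty) (hB : B.Nonempty) (hAB : A.card ≤ B.card)
    (hxy : r ≤ x * y) (hβ : y ^ 2 * B.card / N ≤ 4) :
    x * y * (∑ i ∈ A, ∑ j ∈ B, M i j) / N ≤
      8 * κ * r * levelKernel r x y (x ^ 2 * A.card / N) (y ^ 2 * B.card / N) := by
  have hE : 0 ≤ ∑ i ∈ A, ∑ j ∈ B, M i j :=
    Finset.sum_nonneg fun i _ => Finset.sum_nonneg fun j _ => hM i j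
  have hA' : (0 : ℝ) < A.card := by exact_mod_cast hA.card_pos
  have hB' : (0 : ℝ) < B.card := by exact_mod_cast hB.card_pos
  refine level_pair_bound hN hr hκ hx hy hA' hB' ?_ hE hβ hxy ?_ ?_
  · exact le_trans (by exact_mod_cast Finset.card_le_univ B) hη
  · calc ∑ i ∈ A, ∑ j ∈ B, M i j ≤ ∑ i ∈ A, κ * r ^ 2 :=
          Finset.sum_le_sum fun i _ => (Finset.sum_le_sum_of_subset_of_nonneg
            (Finset.subset_univ B) fun j _ _ => hM i j).trans (hrow i)
      _ = κ * r ^ 2 * A.card := by rw [Finset.sum_const, nsmul_eq_mul, mul_comm]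
  · by_cases h : Real.exp 2 * (r ^ 2 * A.card * B.card / N) < ∑ i ∈ A, ∑ j ∈ B, M i j
    · right
      have h' := hdisc A B hA hB h
      rw [max_eq_right (by exact_mod_cast hAB)] at h'
      exact ⟨h, h'⟩
    · left
      push Not at h
      exact h.trans (mul_le_mul_of_nonneg_right exp_two_le_eight (by positivity))

/-- Contribution of the heavy couples. -/
theorem heavy_sum_le {N r κ : ℝ} (hN : 0 < N) (hr : 0 < r) (hκ : 1 ≤ κ)
    {M : ι → η → ℝ} (hM : ∀ i j, 0 ≤ M i j) (hι : (Fintype.card ι : ℝ) ≤ N)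
    (hη : (Fintype.card η : ℝ) ≤ N) (hrow : ∀ i, ∑ j, M i j ≤ κ * r ^ 2)
    (hcol : ∀ j, ∑ i, M i j ≤ κ * r ^ 2) (hdisc : HasDiscrepancyBound N r κ M)
    {u : ι → ℝ} {v : η → ℝ} (hu0 : ∀ i, 0 ≤ u i) (hv0 : ∀ j, 0 ≤ v j)
    (hu : ∑ i, u i ^ 2 ≤ 1) (hv : ∑ j, v j ^ 2 ≤ 1) :
    ∑ i, ∑ j, (if r / N < u i * v j then u i * v j * M i j else 0) ≤ 768 * κ * r := by
  -- Scaling by `√N` turns the heaviness condition into `r < (u i * w) * (v j * w)`, and the level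
  -- masses `α`, `β` become at most four times the squared masses of the vectors.
  set w := √N with hw_def
  have hw : 0 < w := Real.sqrt_pos.2 hN
  have hwN : w ^ 2 = N := Real.sq_sqrt hN.le
  set h : ι → η → ℝ := fun i j => if r / N < u i * v j then u i * v j * M i j else 0 with hh
  set α : ℤ → ℝ := fun s => ((2 : ℝ) ^ s) ^ 2 * (dyadicLevel w u s).card / N with hα
  set β : ℤ → ℝ := fun t => ((2 : ℝ) ^ t) ^ 2 * (dyadicLevel w v t).card / N with hβ
  have hα0 : ∀ s, 0 ≤ α s := fun s => by positivity
  have hβ0 : ∀ s, 0 ≤ β s := fun s => by positivity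
  have hαs : ∑ s ∈ dyadicRange w u, α s ≤ 4 := by
    have := sum_sq_mul_card_dyadicLevel_le hw hu
    rwa [hwN] at this
  have hβs : ∑ s ∈ dyadicRange w v, β s ≤ 4 := by
    have := sum_sq_mul_card_dyadicLevel_le hw hv
    rwa [hwN] at this
  have hα4 : ∀ s, α s ≤ 4 := fun s => by
    have := sq_mul_card_dyadicLevel_le_four hw hu s
    rwa [hwN] at this
  have hβ4 : ∀ s, β s ≤ 4 := fun s => by
    have := sq_mul_card_dyadicLevel_le_four hw hv s
    rwa [hwN] at this
  have hzero : ∀ i j, ¬ (0 < u i ∧ 0 < v j) → h i j = 0 := by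
    intro i j hij
    simp only [hh]
    rw [if_neg]
    intro hlt
    have h1 : 0 < u i * v j := lt_trans (by positivity) hlt
    exact hij ⟨pos_of_mul_pos_left h1 (hv0 j), pos_of_mul_pos_right h1 (hu0 i)⟩
  have hsplit : ∑ i, ∑ j, h i j = ∑ s ∈ dyadicRange w u, ∑ t ∈ dyadicRange w v,
      ∑ i ∈ dyadicLevel w u s, ∑ j ∈ dyadicLevel w v t, h i j := by
    have e1 : ∀ s, ∑ t ∈ dyadicRange w v, ∑ i ∈ dyadicLevel w u s, ∑ j ∈ dyadicLevel w v t, h i j =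
        ∑ i ∈ dyadicLevel w u s, ∑ j, h i j := by
      intro s
      rw [Finset.sum_comm]
      refine Finset.sum_congr rfl fun i hi => ?_
      rw [sum_dyadicLevel, Finset.sum_filter]
      refine Finset.sum_congr rfl fun j _ => ?_
      split_ifs with hj
      · rfl
      · rw [hzero i j fun h => hj h.2]
    simp_rw [e1]
    rw [sum_dyadicLevel, Finset.sum_filter]
    refine Finset.sum_congr rfl fun i _ => ?_
    split_ifs with hi
    · rfl
    · exact Finset.sum_eq_zero fun j _ => hzero i j fun h => hi h.1
  have hblock : ∀ s t, ∑ i ∈ dyadicLevel w u s, ∑ j ∈ dyadicLevel w v t, h i j ≤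
      8 * κ * r * (levelKernel r (2 ^ s) (2 ^ t) (α s) (β t) +
        levelKernel r (2 ^ t) (2 ^ s) (β t) (α s)) := by
    intro s t
    have hx : (0 : ℝ) < 2 ^ s := by positivity
    have hy : (0 : ℝ) < 2 ^ t := by positivity
    have hk1 := levelKernel_nonneg hr hx hy (hα0 s) (hβ0 t)
    have hk2 := levelKernel_nonneg hr hy hx (hβ0 t) (hα0 s)
    have hc : 0 ≤ 8 * κ * r := by positivity
    by_cases hex : ∃ i ∈ dyadicLevel w u s, ∃ j ∈ dyadicLevel w v t, r / N < u i * v j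
    · obtain ⟨i, hi, j, hj, hij⟩ := hex
      have hiu := lt_of_mem_dyadicLevel hi
      have hjv := lt_of_mem_dyadicLevel hj
      have hxy : r ≤ 2 ^ s * 2 ^ t := by
        rw [div_lt_iff₀ hN] at hij
        calc r ≤ u i * v j * N := hij.le
          _ = (u i * w) * (v j * w) := by rw [← hwN]; ring
          _ ≤ 2 ^ s * 2 ^ t := mul_le_mul hiu.2.le hjv.2.le (mul_pos hjv.1 hw).le hx.le
      have hle : ∑ i ∈ dyadicLevel w u s, ∑ j ∈ dyadicLevel w v t, h i j ≤
          2 ^ s * 2 ^ t * (∑ i ∈ dyadicLevel w u s, ∑ j ∈ dyadicLevel w v t, M i j) / N := by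
        rw [mul_div_assoc, Finset.sum_div, Finset.mul_sum]
        refine Finset.sum_le_sum fun i hi => ?_
        rw [Finset.sum_div, Finset.mul_sum]
        refine Finset.sum_le_sum fun j hj => ?_
        have hiu := lt_of_mem_dyadicLevel hi
        have hjv := lt_of_mem_dyadicLevel hj
        have hMN : 0 ≤ M i j / N := div_nonneg (hM i j) hN.le
        simp only [hh]
        split_ifs
        · calc u i * v j * M i j = (u i * w) * (v j * w) * (M i j / N) := by
                rw [← hwN]; field_simp
            _ ≤ 2 ^ s * 2 ^ t * (M i j / N) := mul_le_mul_of_nonneg_right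
                (mul_le_mul hiu.2.le hjv.2.le (mul_pos hjv.1 hw).le hx.le) hMN
        · positivity
      refine hle.trans ?_
      -- The block estimate is oriented from the smaller side to the larger one; in the other case
      -- the transposed matrix is used, which is why the bound adds two kernels.
      rcases le_total (dyadicLevel w u s).card (dyadicLevel w v t).card with hab | hab
      · refine (block_bound_of_card_le hN hr hκ hx hy hM hη hrow hdisc ⟨i, hi⟩ ⟨j, hj⟩ hab hxy
          (hβ4 t)).trans (mul_le_mul_of_nonneg_left ?_ hc)
        exact le_add_of_nonneg_right hk2
      · rw [Finset.sum_comm, mul_comm ((2 : ℝ) ^ s)]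
        refine (block_bound_of_card_le hN hr hκ hy hx (fun j i => hM i j) hι hcol hdisc.transpose
          ⟨j, hj⟩ ⟨i, hi⟩ hab (by rwa [mul_comm]) (hα4 s)).trans (mul_le_mul_of_nonneg_left ?_ hc)
        exact le_add_of_nonneg_left hk1
    · push Not at hex
      rw [Finset.sum_eq_zero fun i hi => Finset.sum_eq_zero fun j hj =>
        if_neg (not_lt.2 (hex i hi j hj))]
      positivity
  change ∑ i, ∑ j, h i j ≤ _
  rw [hsplit]
  refine (Finset.sum_le_sum fun s _ => Finset.sum_le_sum fun t _ => hblock s t).trans ?_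
  simp_rw [← Finset.mul_sum, Finset.sum_add_distrib]
  have b1 := sum_levelKernel_le r (dyadicRange w u) (dyadicRange w v) hα0 hβ0 hαs hβs
  have b2 := sum_levelKernel_le r (dyadicRange w v) (dyadicRange w u) hβ0 hα0 hβs hαs
  rw [Finset.sum_comm] at b2
  calc _ ≤ 8 * κ * r * (48 + 48) := mul_le_mul_of_nonneg_left (add_le_add b1 b2) (by positivity)
    _ = _ := by ring

end Heavy

/-! ### Half-nets of unit balls -/

section Net

/-- Doubling gives a `1`-separated set in the ball of radius `2`, to which the volume count behind
Besicovitch's theorem applies. -/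
theorem card_le_of_half_separated {E : Type*} [NormedAddCommGroup E] [NormedSpace ℝ E]
    [FiniteDimensional ℝ E] (s : Finset E) (hs : ∀ c ∈ s, ‖c‖ ≤ 1)
    (h : ∀ c ∈ s, ∀ d ∈ s, c ≠ d → 1 / 2 ≤ ‖c - d‖) : s.card ≤ 5 ^ Module.finrank ℝ E := by
  classical
  have hinj : Function.Injective fun c : E => (2 : ℝ) • c :=
    smul_right_injective E (two_ne_zero' ℝ)
  rw [← Finset.card_image_of_injective s hinj]
  refine Besicovitch.card_le_of_separated _ ?_ ?_
  · intro c hc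
    obtain ⟨c, hc', rfl⟩ := Finset.mem_image.1 hc
    rw [norm_smul, Real.norm_two]
    linarith [hs c hc']
  · intro c hc d hd hcd
    obtain ⟨c, hc', rfl⟩ := Finset.mem_image.1 hc
    obtain ⟨d, hd', rfl⟩ := Finset.mem_image.1 hd
    rw [← smul_sub, norm_smul, Real.norm_two]
    linarith [h c hc' d hd' fun h => hcd (by rw [h])]

theorem exists_half_net (E : Type*) [NormedAddCommGroup E] [NormedSpace ℝ E]
    [FiniteDimensional ℝ E] :
    ∃ T : Finset E, T.card ≤ 5 ^ Module.finrank ℝ E ∧ (∀ c ∈ T, ‖c‖ ≤ 1) ∧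
      ∀ x : E, ‖x‖ ≤ 1 → ∃ c ∈ T, ‖x - c‖ ≤ 1 / 2 := by
  classical
  let S : Set ℕ := {k | ∃ s : Finset E, (∀ c ∈ s, ‖c‖ ≤ 1) ∧
    (∀ c ∈ s, ∀ d ∈ s, c ≠ d → 1 / 2 ≤ ‖c - d‖) ∧ s.card = k}
  have hbdd : BddAbove S := by
    refine ⟨5 ^ Module.finrank ℝ E, ?_⟩
    rintro k ⟨s, h1, h2, rfl⟩
    exact card_le_of_half_separated s h1 h2
  have hne : S.Nonempty := ⟨0, ∅, by simp, by simp, rfl⟩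
  -- A separated set of maximal size is a net, since a point far from all of it could be added.
  obtain ⟨s, h1, h2, h3⟩ := Nat.sSup_mem hne hbdd
  refine ⟨s, card_le_of_half_separated s h1 h2, h1, fun x hx => ?_⟩
  by_contra! hfar
  have hxs : x ∉ s := fun h => by
    have := hfar x h
    norm_num at this
  have hmem : s.card + 1 ∈ S := by
    refine ⟨insert x s, ?_, ?_, Finset.card_insert_of_notMem hxs⟩
    · intro c hc
      rcases Finset.mem_insert.1 hc with rfl | hc
      exacts [hx, h1 c hc]
    · intro c hc d hd hcd
      rcases Finset.mem_insert.1 hc with rfl | hc' <;> rcases Finset.mem_insert.1 hd with rfl | hd'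
      · exact absurd rfl hcd
      · exact (hfar d hd').le
      · rw [norm_sub_rev]; exact (hfar c hc').le
      · exact h2 c hc' d hd' hcd
  have := le_csSup hbdd hmem
  omega

theorem norm_le_two_mul_of_net {F : Type*} [NormedAddCommGroup F] [InnerProductSpace ℝ F]
    {T : Finset F} (hT : ∀ x : F, ‖x‖ ≤ 1 → ∃ c ∈ T, ‖x - c‖ ≤ 1 / 2) {y : F} {B : ℝ} (hB : 0 ≤ B)
    (h : ∀ u ∈ T, inner ℝ u y ≤ B) : ‖y‖ ≤ 2 * B := by
  rcases eq_or_ne y 0 with rfl | hy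
  · simpa using hB
  have hy' : 0 < ‖y‖ := norm_pos_iff.2 hy
  obtain ⟨u, hu, hxu⟩ := hT (‖y‖⁻¹ • y) (by rw [norm_smul, norm_inv, norm_norm,
    inv_mul_cancel₀ hy'.ne'])
  have h1 : inner ℝ (‖y‖⁻¹ • y) y = ‖y‖ := by
    rw [real_inner_smul_left, real_inner_self_eq_norm_sq]
    field_simp
  have h2 : inner ℝ (‖y‖⁻¹ • y - u) y ≤ 1 / 2 * ‖y‖ :=
    (real_inner_le_norm _ _).trans (mul_le_mul_of_nonneg_right hxu hy'.le)
  rw [inner_sub_left, h1] at h2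
  linarith [h u hu]

/-- Rounding a unit vector to the net costs at most half of the norm being estimated, which is
absorbed on the left; each of the two nets thus costs a factor `2`. -/
theorem opNorm_le_four_mul_of_net {E F : Type*} [NormedAddCommGroup E] [NormedSpace ℝ E]
    [NormedAddCommGroup F] [InnerProductSpace ℝ F] {T : Finset F} {T' : Finset E}
    (hT : ∀ x : F, ‖x‖ ≤ 1 → ∃ c ∈ T, ‖x - c‖ ≤ 1 / 2)
    (hT' : ∀ x : E, ‖x‖ ≤ 1 → ∃ c ∈ T', ‖x - c‖ ≤ 1 / 2) (L : E →L[ℝ] F) {B : ℝ} (hB : 0 ≤ B)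
    (h : ∀ u ∈ T, ∀ v ∈ T', inner ℝ u (L v) ≤ B) : ‖L‖ ≤ 4 * B := by
  have key : ‖L‖ ≤ 2 * B + ‖L‖ * (1 / 2) := by
    refine L.opNorm_le_of_unit_norm (by positivity) fun x hx => ?_
    obtain ⟨v, hv, hxv⟩ := hT' x hx.le
    calc ‖L x‖ = ‖L v + L (x - v)‖ := by rw [← map_add, add_sub_cancel]
      _ ≤ ‖L v‖ + ‖L (x - v)‖ := norm_add_le _ _
      _ ≤ 2 * B + ‖L‖ * (1 / 2) := add_le_add
          (norm_le_two_mul_of_net hT hB fun u hu => h u hu v hv)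
          ((L.le_opNorm _).trans (by gcongr))
  linarith

end Net

/-! ### Operator norms of matrices -/

section MatrixNorm

variable {ι η : Type*} [Fintype ι] [Fintype η] [DecidableEq η]

theorem Matrix.l2_opNorm_le_of_net {T : Finset (EuclideanSpace ℝ ι)}
    {T' : Finset (EuclideanSpace ℝ η)}
    (hT : ∀ x : EuclideanSpace ℝ ι, ‖x‖ ≤ 1 → ∃ c ∈ T, ‖x - c‖ ≤ 1 / 2)
    (hT' : ∀ x : EuclideanSpace ℝ η, ‖x‖ ≤ 1 → ∃ c ∈ T', ‖x - c‖ ≤ 1 / 2) (A : Matrix ι η ℝ) {B : ℝ}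
    (hB : 0 ≤ B) (h : ∀ u ∈ T, ∀ v ∈ T', ∑ i, ∑ j, u i * v j * A i j ≤ B) : ‖A‖ ≤ 4 * B := by
  rw [Matrix.l2_opNorm_def]
  refine opNorm_le_four_mul_of_net hT hT' _ hB fun u hu v hv => ?_
  refine le_trans (le_of_eq ?_) (h u hu v hv)
  simp only [PiLp.inner_apply, LinearEquiv.trans_apply, LinearMap.coe_toContinuousLinearMap']
  refine Finset.sum_congr rfl fun i _ => ?_
  simp only [Matrix.toLpLin_apply, Matrix.mulVec, dotProduct, RCLike.inner_apply, conj_trivial]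
  rw [Finset.sum_mul]
  exact Finset.sum_congr rfl fun j _ => by ring

theorem Matrix.sum_mulVec_sq_le (A : Matrix ι η ℝ) (x : η → ℝ) :
    ∑ i, (A.mulVec x) i ^ 2 ≤ ‖A‖ ^ 2 * ∑ j, x j ^ 2 := by
  have h := pow_le_pow_left₀ (norm_nonneg _) (A.l2_opNorm_mulVec (WithLp.toLp 2 x)) 2
  rw [mul_pow, EuclideanSpace.norm_sq_eq, EuclideanSpace.norm_sq_eq] at h
  simpa using h

theorem Matrix.l2_opNorm_le_of_sum_sq {A : Matrix ι η ℝ} {C : ℝ} (hC : 0 ≤ C)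
    (h : ∀ x : η → ℝ, ∑ i, (A.mulVec x) i ^ 2 ≤ C ^ 2 * ∑ j, x j ^ 2) : ‖A‖ ≤ C := by
  rw [Matrix.l2_opNorm_def]
  refine ContinuousLinearMap.opNorm_le_bound _ hC fun x => ?_
  refine le_of_sq_le_sq ?_ (by positivity)
  rw [mul_pow, EuclideanSpace.norm_sq_eq, EuclideanSpace.norm_sq_eq]
  simpa using h x

/-- Splitting the rows into `k` blocks. -/
theorem Matrix.l2_opNorm_le_of_row_blocks {k : ℕ} (f : ι → Fin k) (A : Matrix ι η ℝ) {B : ℝ}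
    (hB : 0 ≤ B) (h : ∀ l, ‖A.submatrix (Subtype.val : {i // f i = l} → ι) id‖ ≤ B) :
    ‖A‖ ≤ √k * B := by
  refine Matrix.l2_opNorm_le_of_sum_sq (by positivity) fun x => ?_
  rw [mul_pow, Real.sq_sqrt (Nat.cast_nonneg k)]
  calc ∑ i, (A.mulVec x) i ^ 2 = ∑ l, ∑ i : {i // f i = l}, (A.mulVec x) i ^ 2 :=
        (Fintype.sum_fiberwise f fun i => (A.mulVec x) i ^ 2).symm
    _ ≤ ∑ l : Fin k, B ^ 2 * ∑ j, x j ^ 2 := by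
        refine Finset.sum_le_sum fun l _ => ?_
        refine le_trans (Matrix.sum_mulVec_sq_le
          (A.submatrix (Subtype.val : {i // f i = l} → ι) id) x) ?_
        gcongr
        exact h l
    _ = k * B ^ 2 * ∑ j, x j ^ 2 := by simp [mul_assoc]

/-- Each column is the image of a basis vector, so its length is at most the operator norm. This is
the source of the lower bound. -/
theorem Matrix.sum_sq_le_card_mul_l2_opNorm_sq (A : Matrix ι η ℝ) :
    ∑ i, ∑ j, A i j ^ 2 ≤ Fintype.card η * ‖A‖ ^ 2 := by
  rw [Finset.sum_comm]
  calc ∑ j, ∑ i, A i j ^ 2 ≤ ∑ _j : η, ‖A‖ ^ 2 := by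
        refine Finset.sum_le_sum fun j _ => ?_
        have h := A.sum_mulVec_sq_le (Pi.single j 1)
        simpa [Pi.single_apply, ite_pow] using h
    _ = _ := by simp

end MatrixNorm

/-! ### Chernoff bounds from Poisson exponential moments -/

section Tails

variable {Ω : Type*} [MeasurableSpace Ω] {P : Measure Ω} [IsProbabilityMeasure P]
  {ι η : Type*} [Fintype ι] [Fintype η]

/-- The exponential moments of the linear functionals of `M` are at most those of a matrix with
independent Poisson entries of mean `p`. -/
def HasPoissonMGFBound (P : Measure Ω) (p : ℝ) (M : Ω → Matrix ι η ℝ) : Prop :=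
  ∀ b : ι → η → ℝ, Integrable (fun ω => Real.exp (∑ i, ∑ j, b i j * M ω i j)) P ∧
    ∫ ω, Real.exp (∑ i, ∑ j, b i j * M ω i j) ∂P ≤
      Real.exp (p * ∑ i, ∑ j, (Real.exp (b i j) - 1))

theorem HasPoissonMGFBound.tail {p : ℝ} {M : Ω → Matrix ι η ℝ} (h : HasPoissonMGFBound P p M)
    (b : ι → η → ℝ) (ε : ℝ) :
    P.real {ω | ε ≤ ∑ i, ∑ j, b i j * M ω i j} ≤
      Real.exp (p * ∑ i, ∑ j, (Real.exp (b i j) - 1) - ε) := by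
  obtain ⟨h1, h2⟩ := h b
  have h3 := measure_ge_le_exp_mul_mgf (μ := P) (X := fun ω => ∑ i, ∑ j, b i j * M ω i j)
    (t := 1) ε zero_le_one (by simpa only [one_mul] using h1)
  simp only [mgf, one_mul, neg_mul] at h3
  refine h3.trans ((mul_le_mul_of_nonneg_left h2 (Real.exp_pos _).le).trans (le_of_eq ?_))
  rw [← Real.exp_add]
  congr 1
  ring

/-- Contribution of the light couples of a fixed pair of vectors. -/
theorem HasPoissonMGFBound.light_tail {p N r : ℝ} {M : Ω → Matrix ι η ℝ}
    (h : HasPoissonMGFBound P p M) (hp : 0 ≤ p) (hN : 0 < N) (hr : 0 < r) (hpN : p * N ≤ r ^ 2)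
    {u : ι → ℝ} {v : η → ℝ} (hu : ∑ i, u i ^ 2 ≤ 1) (hv : ∑ j, v j ^ 2 ≤ 1) (t : ℝ) :
    P.real {ω | t * r ≤ ∑ i, ∑ j,
      (if |u i * v j| ≤ r / N then u i * v j * (M ω i j - p) else 0)} ≤ Real.exp (N - t * N) := by
  -- Tilting by `N / r` is the largest tilt keeping the coefficients in `[-1, 1]` on all light
  -- couples, where `exp b ≤ 1 + b + b ^ 2`. The linear term cancels the centring and the quadratic
  -- one costs at most `N`.
  set b : ι → η → ℝ := fun i j => if |u i * v j| ≤ r / N then N / r * (u i * v j) else 0 with hb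
  have hlam : 0 < N / r := by positivity
  have hb1 : ∀ i j, |b i j| ≤ 1 := by
    intro i j
    simp only [hb]
    split_ifs with hij
    · rw [abs_mul, abs_of_pos hlam]
      calc N / r * |u i * v j| ≤ N / r * (r / N) := by gcongr
        _ = 1 := by field_simp
    · simp
  have hb2 : ∀ i j, b i j ^ 2 ≤ (N / r) ^ 2 * (u i ^ 2 * v j ^ 2) := by
    intro i j
    simp only [hb]
    split_ifs with hij
    · exact le_of_eq (by ring)
    · rw [zero_pow two_ne_zero]; positivity
  have hsq : p * ∑ i, ∑ j, b i j ^ 2 ≤ N := by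
    have hprod : ∑ i, ∑ j, u i ^ 2 * v j ^ 2 ≤ 1 := by
      rw [← Finset.sum_mul_sum]
      exact mul_le_one₀ hu (Finset.sum_nonneg fun j _ => sq_nonneg _) hv
    calc p * ∑ i, ∑ j, b i j ^ 2 ≤ p * ∑ i, ∑ j, (N / r) ^ 2 * (u i ^ 2 * v j ^ 2) := by
          gcongr with i _ j _; exact hb2 i j
      _ = p * (N / r) ^ 2 * ∑ i, ∑ j, u i ^ 2 * v j ^ 2 := by simp_rw [← Finset.mul_sum, mul_assoc]
      _ ≤ p * (N / r) ^ 2 * 1 := by gcongr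
      _ = (p * N) * N / r ^ 2 := by field_simp
      _ ≤ r ^ 2 * N / r ^ 2 := by gcongr
      _ = N := by field_simp
  have hexp : ∑ i, ∑ j, (Real.exp (b i j) - 1) ≤ ∑ i, ∑ j, b i j + ∑ i, ∑ j, b i j ^ 2 := by
    simp_rw [← Finset.sum_add_distrib]
    gcongr with i _ j _
    have := (abs_le.1 (Real.abs_exp_sub_one_sub_id_le (hb1 i j))).2
    linarith
  have hsub : {ω | t * r ≤ ∑ i, ∑ j,
      (if |u i * v j| ≤ r / N then u i * v j * (M ω i j - p) else 0)} ⊆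
      {ω | t * N + p * ∑ i, ∑ j, b i j ≤ ∑ i, ∑ j, b i j * M ω i j} := by
    intro ω hω
    have e : N / r * ∑ i, ∑ j, (if |u i * v j| ≤ r / N then u i * v j * (M ω i j - p) else 0) =
        ∑ i, ∑ j, b i j * M ω i j - p * ∑ i, ∑ j, b i j := by
      simp_rw [Finset.mul_sum, ← Finset.sum_sub_distrib]
      refine Finset.sum_congr rfl fun i _ => Finset.sum_congr rfl fun j _ => ?_
      simp only [hb]
      split_ifs <;> ring
    have h1 : N / r * (t * r) ≤ N / r * _ := mul_le_mul_of_nonneg_left hω hlam.le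
    rw [e, show N / r * (t * r) = t * N by field_simp] at h1
    simp only [Set.mem_ofPred_eq]
    linarith
  refine (measureReal_mono hsub).trans ((h.tail b _).trans (Real.exp_le_exp.2 ?_))
  have := mul_le_mul_of_nonneg_left hexp hp
  linarith

theorem HasPoissonMGFBound.block_tail {p : ℝ} {M : Ω → Matrix ι η ℝ}
    (h : HasPoissonMGFBound P p M) (A : Finset ι) (B : Finset η) (θ ε : ℝ) :
    P.real {ω | θ * ε ≤ θ * ∑ i ∈ A, ∑ j ∈ B, M ω i j} ≤
      Real.exp (p * (A.card * B.card * (Real.exp θ - 1)) - θ * ε) := by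
  classical
  have h1 := h.tail (fun i j => if i ∈ A ∧ j ∈ B then θ else 0) (θ * ε)
  have e1 : ∀ ω, ∑ i, ∑ j, (if i ∈ A ∧ j ∈ B then θ else 0) * M ω i j =
      θ * ∑ i ∈ A, ∑ j ∈ B, M ω i j := by
    intro ω
    simp_rw [Finset.mul_sum, ite_mul, zero_mul, ite_and]
    simp [Finset.sum_ite_mem]
  have e2 : ∑ i, ∑ j, (Real.exp (if i ∈ A ∧ j ∈ B then θ else 0) - 1) =
      A.card * B.card * (Real.exp θ - 1) := by
    have : ∀ i j, Real.exp (if i ∈ A ∧ j ∈ B then θ else 0) - 1 =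
        if i ∈ A then (if j ∈ B then Real.exp θ - 1 else 0) else 0 := by
      intro i j
      by_cases hi : i ∈ A <;> by_cases hj : j ∈ B <;> simp [hi, hj]
    simp_rw [this]
    simp
    ring
  simp_rw [e1, e2] at h1
  exact h1

theorem HasPoissonMGFBound.col_tail {p N r : ℝ} {M : Ω → Matrix ι η ℝ}
    (h : HasPoissonMGFBound P p M) (hp : 0 ≤ p) (hpN : p * N ≤ r ^ 2)
    (hι : (Fintype.card ι : ℝ) ≤ N) (j : η) (ε : ℝ) :
    P.real {ω | ε ≤ ∑ i, M ω i j} ≤ Real.exp (2 * r ^ 2 - ε) := by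
  have h1 := h.block_tail Finset.univ {j} 1 ε
  simp only [one_mul, Finset.sum_singleton, Finset.card_univ, Finset.card_singleton, Nat.cast_one,
    mul_one] at h1
  refine h1.trans (Real.exp_le_exp.2 (sub_le_sub_right ?_ _))
  have he := Real.exp_one_lt_d9
  have he1 := Real.one_lt_exp_iff.2 one_pos
  calc p * (Fintype.card ι * (Real.exp 1 - 1)) ≤ p * (N * 2) := by
        gcongr <;> linarith
    _ ≤ 2 * r ^ 2 := by linarith

/-- A violation of the discrepancy property on a fixed block is unlikely. -/
theorem HasPoissonMGFBound.disc_tail {p N r : ℝ} {M : Ω → Matrix ι η ℝ}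
    (h : HasPoissonMGFBound P p M) (hN : 0 < N) (hr : 0 < r) (hpN : p * N ≤ r ^ 2)
    {A : Finset ι} {B : Finset η} (hA : A.Nonempty) (hB : B.Nonempty) (K : ℝ) :
    P.real {ω | (∀ i j, M ω i j = 0 ∨ M ω i j = 1) ∧
      Real.exp 2 * (r ^ 2 * A.card * B.card / N) < ∑ i ∈ A, ∑ j ∈ B, M ω i j ∧
      K < (∑ i ∈ A, ∑ j ∈ B, M ω i j) *
        Real.log ((∑ i ∈ A, ∑ j ∈ B, M ω i j) / (r ^ 2 * A.card * B.card / N))} ≤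
      Real.exp (-(K / 2)) := by
  classical
  have hA' : (0 : ℝ) < A.card := by exact_mod_cast hA.card_pos
  have hB' : (0 : ℝ) < B.card := by exact_mod_cast hB.card_pos
  set μ := r ^ 2 * A.card * B.card / N with hμ_def
  have hμ : 0 < μ := by positivity
  have hpμ : p * (A.card * B.card) ≤ μ := by
    rw [hμ_def, le_div_iff₀ hN]
    calc p * (A.card * B.card) * N = (p * N) * (A.card * B.card) := by ring
      _ ≤ r ^ 2 * (A.card * B.card) := by gcongr
      _ = _ := by ring
  set Q : ℕ → Prop := fun k => Real.exp 2 * μ < k ∧ K < k * Real.log (k / μ) with hQ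
  have hnat : ∀ ω, (∀ i j, M ω i j = 0 ∨ M ω i j = 1) →
      ∃ k : ℕ, ∑ i ∈ A, ∑ j ∈ B, M ω i j = k := by
    intro ω hω
    have : ∀ i j, ∃ k : ℕ, M ω i j = k := fun i j => by
      rcases hω i j with h | h
      exacts [⟨0, by simpa using h⟩, ⟨1, by simpa using h⟩]
    choose k hk using this
    exact ⟨∑ i ∈ A, ∑ j ∈ B, k i j, by push_cast; simp_rw [hk]⟩
  by_cases hex : ∃ k, Q k
  -- Zero-one entries make the count an integer, so a violation forces it to reach the least
  -- violating integer `x`. One Chernoff bound, with the optimal Poisson tilt `log (x / μ)`, then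
  -- covers all violations.
  · obtain ⟨hq1, hq2⟩ := Nat.find_spec hex
    set x : ℝ := ((Nat.find hex : ℕ) : ℝ) with hx
    have hx0 : 0 < x := lt_trans (by positivity) hq1
    have hlog : 2 < Real.log (x / μ) := by
      rw [Real.lt_log_iff_exp_lt (by positivity), lt_div_iff₀ hμ]
      exact hq1
    refine le_trans (measureReal_mono ?_) ((h.block_tail A B (Real.log (x / μ))
      x).trans (Real.exp_le_exp.2 ?_))
    · rintro ω ⟨h01, h1, h2⟩
      obtain ⟨k, hk⟩ := hnat ω h01
      simp only [Set.mem_ofPred_eq]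
      rw [hk] at h1 h2 ⊢
      have : Nat.find hex ≤ k := Nat.find_min' hex ⟨h1, h2⟩
      refine mul_le_mul_of_nonneg_left ?_ (by linarith)
      rw [hx]
      exact_mod_cast this
    · rw [Real.exp_log (by positivity)]
      have h1 : p * (A.card * B.card * (x / μ - 1)) ≤ x := by
        have hxm : 0 ≤ x / μ - 1 := by
          have := Real.add_one_le_exp 2
          rw [sub_nonneg, one_le_div hμ]
          linarith [le_mul_of_one_le_left hμ.le (by linarith : 1 ≤ Real.exp 2)]
        calc p * (A.card * B.card * (x / μ - 1)) = p * (A.card * B.card) * (x / μ - 1) := by ring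
          _ ≤ μ * (x / μ - 1) := by gcongr
          _ = x - μ := by field_simp
          _ ≤ x := by linarith
      -- The threshold `exp 2` makes the logarithm exceed `2`, so the cost `x` uses up at most half
      -- of the exponent.
      have h2 : x * 2 ≤ x * Real.log (x / μ) := by gcongr
      linarith
  · refine le_trans (measureReal_mono (s₂ := ∅) ?_) (by simpa using (Real.exp_pos _).le)
    rintro ω ⟨h01, h1, h2⟩
    obtain ⟨k, hk⟩ := hnat ω h01
    rw [hk] at h1 h2
    exact hex ⟨k, h1, h2⟩

end Tails

/-! ### Entropy sums over subsets -/

section Entropy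

theorem mul_one_add_log_div_mono {N c c' : ℝ} (hc : 0 < c) (hcc : c ≤ c') (hN : c' ≤ N) :
    c * (1 + Real.log (N / c)) ≤ c' * (1 + Real.log (N / c')) := by
  have hc' : 0 < c' := hc.trans_le hcc
  have hN0 : 0 < N := hc'.trans_le hN
  have h1 : Real.log (N / c) = Real.log (N / c') + Real.log (c' / c) := by
    rw [← Real.log_mul (by positivity) (by positivity)]
    congr 1; field_simp
  have h2 : c * Real.log (c' / c) ≤ c' - c := by
    calc c * Real.log (c' / c) ≤ c * (c' / c - 1) := by
          gcongr; exact Real.log_le_sub_one_of_pos (by positivity)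
      _ = c' - c := by field_simp
  have h3 : 0 ≤ Real.log (N / c') := Real.log_nonneg ((one_le_div hc').2 hN)
  rw [h1]
  nlinarith

theorem choose_le_exp_entropy {n a : ℕ} {N : ℝ} (hn : (n : ℝ) ≤ N) (hN : 0 < N) (ha : 0 < a) :
    (n.choose a : ℝ) ≤ Real.exp (a * (1 + Real.log (N / a))) := by
  have ha' : (0 : ℝ) < a := by exact_mod_cast ha
  have h1 := Real.pow_div_factorial_le_exp (a : ℝ) ha'.le a
  have hf : (0 : ℝ) < a.factorial := by exact_mod_cast a.factorial_pos
  calc (n.choose a : ℝ) ≤ (n : ℝ) ^ a / a.factorial := Nat.choose_le_pow_div a n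
    _ ≤ N ^ a / a.factorial := by gcongr
    _ = (N / a) ^ a * ((a : ℝ) ^ a / a.factorial) := by rw [div_pow]; field_simp
    _ ≤ (N / a) ^ a * Real.exp a := by gcongr
    _ = _ := by
        rw [mul_add, mul_one, Real.exp_add, mul_comm, Real.exp_nat_mul _ a, Real.exp_log (by positivity)]

/-- Counting the sets of a given size uses up one of the `q` entropies. By monotonicity the rest is
at least `(q - 1) * log N`, and there are at most `N` sizes. -/
theorem sum_exp_neg_entropy_le {ι : Type*} [Fintype ι] {N q : ℝ} (hN : 1 ≤ N) (hq : 1 ≤ q)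
    (hι : (Fintype.card ι : ℝ) ≤ N) :
    ∑ A : Finset ι with A.Nonempty, Real.exp (-(q * (A.card * (1 + Real.log (N / A.card))))) ≤
      Real.exp ((2 - q) * Real.log N) := by
  classical
  have hN0 : 0 < N := by linarith
  have hlogN : 0 ≤ Real.log N := Real.log_nonneg hN
  set g : ℕ → ℝ := fun a => if a = 0 then 0 else
    Real.exp (-(q * (a * (1 + Real.log (N / a))))) with hg
  have e1 : ∑ A : Finset ι with A.Nonempty,
      Real.exp (-(q * (A.card * (1 + Real.log (N / A.card))))) =
      ∑ A ∈ (Finset.univ : Finset ι).powerset, g A.card := by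
    rw [Finset.sum_filter, Finset.powerset_univ]
    refine Finset.sum_congr rfl fun A _ => ?_
    rcases A.eq_empty_or_nonempty with rfl | hA
    · simp [hg]
    · simp [hg, hA, hA.ne_empty]
  rw [e1, Finset.sum_powerset_apply_card, Finset.card_univ, Finset.sum_range_succ']
  have hbound : ∀ a ∈ Finset.range (Fintype.card ι),
      (Fintype.card ι).choose (a + 1) • g (a + 1) ≤ Real.exp (-((q - 1) * Real.log N)) := by
    intro a ha
    have ha1 : ((a + 1 : ℕ) : ℝ) ≤ N :=
      le_trans (by exact_mod_cast Finset.mem_range.1 ha) hι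
    have hpos : (0 : ℝ) < (a + 1 : ℕ) := by exact_mod_cast a.succ_pos
    have h1 := choose_le_exp_entropy hι hN0 a.succ_pos
    have h2 := mul_one_add_log_div_mono (N := N) one_pos
      (show (1 : ℝ) ≤ (a + 1 : ℕ) by exact_mod_cast Nat.le_add_left 1 a) ha1
    rw [one_mul, div_one] at h2
    simp only [hg, Nat.succ_ne_zero, if_false, nsmul_eq_mul]
    refine (mul_le_mul_of_nonneg_right h1 (Real.exp_pos _).le).trans ?_
    rw [← Real.exp_add]
    refine Real.exp_le_exp.2 ?_
    have h3 : (q - 1) * Real.log N ≤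
        (q - 1) * (((a + 1 : ℕ) : ℝ) * (1 + Real.log (N / (a + 1 : ℕ)))) := by
      gcongr
      · linarith
    linarith
  have h0 : (Fintype.card ι).choose 0 • g 0 = 0 := by simp [hg]
  rw [h0, add_zero]
  calc _ ≤ ∑ _a ∈ Finset.range (Fintype.card ι), Real.exp (-((q - 1) * Real.log N)) :=
        Finset.sum_le_sum hbound
    _ = Fintype.card ι * Real.exp (-((q - 1) * Real.log N)) := by simp
    _ ≤ N * Real.exp (-((q - 1) * Real.log N)) := by gcongr
    _ = Real.exp (Real.log N) * Real.exp (-((q - 1) * Real.log N)) := by rw [Real.exp_log hN0]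
    _ = _ := by rw [← Real.exp_add]; congr 1; ring

end Entropy

/-! ### The norm of one block -/

section Core

variable {Ω : Type*} [MeasurableSpace Ω] {P : Measure Ω} [IsProbabilityMeasure P]
  {ι η : Type*} [Fintype ι] [Fintype η]

theorem exists_half_net_euclidean (ι : Type*) [Fintype ι] {N : ℝ} (hι : (Fintype.card ι : ℝ) ≤ N) :
    ∃ T : Finset (EuclideanSpace ℝ ι), (T.card : ℝ) ≤ Real.exp (2 * N) ∧
      (∀ c ∈ T, ∑ i, c i ^ 2 ≤ 1) ∧
      ∀ x : EuclideanSpace ℝ ι, ‖x‖ ≤ 1 → ∃ c ∈ T, ‖x - c‖ ≤ 1 / 2 := by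
  obtain ⟨T, hcard, hT1, hT⟩ := exists_half_net (EuclideanSpace ℝ ι)
  refine ⟨T, ?_, fun c hc => ?_, hT⟩
  · rw [finrank_euclideanSpace] at hcard
    have h5 : (5 : ℝ) ≤ Real.exp 2 := by
      have h := Real.exp_one_gt_d9
      have h2 : Real.exp 2 = Real.exp 1 * Real.exp 1 := by rw [← Real.exp_add]; norm_num
      rw [h2]
      nlinarith
    calc (T.card : ℝ) ≤ 5 ^ Fintype.card ι := by exact_mod_cast hcard
      _ ≤ Real.exp 2 ^ Fintype.card ι := by gcongr
      _ = Real.exp (Fintype.card ι * 2) := by rw [Real.exp_nat_mul]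
      _ ≤ Real.exp (2 * N) := Real.exp_le_exp.2 (by linarith)
  · have h := pow_le_pow_left₀ (norm_nonneg c) (hT1 c hc) 2
    rw [EuclideanSpace.norm_sq_eq] at h
    simpa using h

/-- The bilinear form of the centred matrix, split into light and heavy couples. -/
theorem bilinear_le_light_add_heavy {p N r κ L : ℝ} (hp : 0 ≤ p) (hN : 0 < N) (hr : 0 < r)
    (hpN : p * N ≤ r ^ 2) (hκ : 1 ≤ κ) {M : ι → η → ℝ} (hM : ∀ i j, 0 ≤ M i j)
    (hι : (Fintype.card ι : ℝ) ≤ N) (hη : (Fintype.card η : ℝ) ≤ N)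
    (hrow : ∀ i, ∑ j, M i j ≤ κ * r ^ 2) (hcol : ∀ j, ∑ i, M i j ≤ κ * r ^ 2)
    (hdisc : HasDiscrepancyBound N r κ M) {u : ι → ℝ} {v : η → ℝ} (hu : ∑ i, u i ^ 2 ≤ 1)
    (hv : ∑ j, v j ^ 2 ≤ 1)
    (hlight : ∑ i, ∑ j, (if |u i * v j| ≤ r / N then u i * v j * (M i j - p) else 0) ≤ L) :
    ∑ i, ∑ j, u i * v j * (M i j - p) ≤ L + 768 * κ * r + r := by
  have hheavy := heavy_sum_le hN hr hκ hM hι hη hrow hcol hdisc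
    (u := fun i => |u i|) (v := fun j => |v j|) (fun i => abs_nonneg _) (fun j => abs_nonneg _)
    (by simpa using hu) (by simpa using hv)
  have hmean : ∑ i, ∑ j, p * N / r * (u i ^ 2 * v j ^ 2) ≤ r := by
    simp_rw [← Finset.mul_sum]
    rw [← Finset.sum_mul]
    have hprod : (∑ i, u i ^ 2) * ∑ j, v j ^ 2 ≤ 1 :=
      mul_le_one₀ hu (Finset.sum_nonneg fun j _ => sq_nonneg _) hv
    calc p * N / r * ((∑ i, u i ^ 2) * ∑ j, v j ^ 2) ≤ r ^ 2 / r * 1 := by gcongr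
      _ = r := by field_simp
  refine le_trans ?_ (add_le_add (add_le_add hlight hheavy) hmean)
  simp_rw [← Finset.sum_add_distrib]
  refine Finset.sum_le_sum fun i _ => Finset.sum_le_sum fun j _ => ?_
  have hsq : 0 ≤ p * N / r * (u i ^ 2 * v j ^ 2) := by positivity
  by_cases h : |u i * v j| ≤ r / N
  · rw [if_pos h, if_neg (by rw [← abs_mul]; exact not_lt.2 h)]
    linarith
  · rw [if_neg h, if_pos (by rw [← abs_mul]; exact not_le.1 h), ← abs_mul, zero_add]
    push Not at h
    have h1 : u i * v j * M i j ≤ |u i * v j| * M i j :=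
      mul_le_mul_of_nonneg_right (le_abs_self _) (hM i j)
    -- On a heavy couple `N / r * |u i * v j|` exceeds `1`; multiplying by it makes the mean part
    -- summable, with total at most `r`.
    have h2 : |u i * v j| ≤ N / r * (u i ^ 2 * v j ^ 2) := by
      rw [← mul_pow, ← sq_abs (u i * v j), sq, ← mul_assoc]
      refine le_mul_of_one_le_left (abs_nonneg _) ?_
      calc (1 : ℝ) = N / r * (r / N) := by field_simp
        _ ≤ N / r * |u i * v j| := by gcongr
    have h3 : p * -(u i * v j) ≤ p * (N / r * (u i ^ 2 * v j ^ 2)) :=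
      mul_le_mul_of_nonneg_left ((neg_le_abs _).trans h2) hp
    have h4 : p * (N / r * (u i ^ 2 * v j ^ 2)) = p * N / r * (u i ^ 2 * v j ^ 2) := by ring
    linarith

/-- Simultaneous discrepancy property. -/
theorem HasPoissonMGFBound.disc_tail_all {p N r κ : ℝ} {M : Ω → Matrix ι η ℝ}
    (h : HasPoissonMGFBound P p M) (hN : 1 ≤ N) (hr : 0 < r) (hpN : p * N ≤ r ^ 2)
    (hκ : 4 ≤ κ) (hι : (Fintype.card ι : ℝ) ≤ N) (hη : (Fintype.card η : ℝ) ≤ N) :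
    P.real {ω | (∀ i j, M ω i j = 0 ∨ M ω i j = 1) ∧ ¬ HasDiscrepancyBound N r κ (M ω)} ≤
      Real.exp ((4 - κ / 2) * Real.log N) := by
  classical
  have hN0 : 0 < N := by linarith
  set f : ℝ → ℝ := fun c => c * (1 + Real.log (N / c)) with hf
  set bad : Finset ι → Finset η → Set Ω := fun A B =>
    {ω | (∀ i j, M ω i j = 0 ∨ M ω i j = 1) ∧
      Real.exp 2 * (r ^ 2 * A.card * B.card / N) < ∑ i ∈ A, ∑ j ∈ B, M ω i j ∧
      κ * f (max (A.card : ℝ) B.card) < (∑ i ∈ A, ∑ j ∈ B, M ω i j) *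
        Real.log ((∑ i ∈ A, ∑ j ∈ B, M ω i j) / (r ^ 2 * A.card * B.card / N))} with hbad
  have hsub : {ω | (∀ i j, M ω i j = 0 ∨ M ω i j = 1) ∧ ¬ HasDiscrepancyBound N r κ (M ω)} ⊆
      ⋃ A ∈ Finset.univ.filter (fun A : Finset ι => A.Nonempty),
        ⋃ B ∈ Finset.univ.filter (fun B : Finset η => B.Nonempty), bad A B := by
    rintro ω ⟨h01, hω⟩
    unfold HasDiscrepancyBound at hω
    push Not at hω
    obtain ⟨A, B, hA, hB, h1, h2⟩ := hω
    refine Set.mem_biUnion (Finset.mem_filter.2 ⟨Finset.mem_univ A, hA⟩)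
      (Set.mem_biUnion (Finset.mem_filter.2 ⟨Finset.mem_univ B, hB⟩) ⟨h01, h1, h2⟩)
  have hq : 1 ≤ κ / 4 := by linarith
  calc _ ≤ ∑ A : Finset ι with A.Nonempty, ∑ B : Finset η with B.Nonempty, P.real (bad A B) :=
        (measureReal_mono hsub (measure_ne_top _ _)).trans ((measureReal_biUnion_finset_le _ _).trans
          (Finset.sum_le_sum fun A _ => measureReal_biUnion_finset_le _ _))
    _ ≤ ∑ A : Finset ι with A.Nonempty, ∑ B : Finset η with B.Nonempty,
        Real.exp (-(κ / 4 * f A.card)) * Real.exp (-(κ / 4 * f B.card)) := by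
        refine Finset.sum_le_sum fun A hA => Finset.sum_le_sum fun B hB => ?_
        have hA' := (Finset.mem_filter.1 hA).2
        have hB' := (Finset.mem_filter.1 hB).2
        refine (h.disc_tail hN0 hr hpN hA' hB' _).trans ?_
        rw [← Real.exp_add]
        refine Real.exp_le_exp.2 ?_
        have hAN : (A.card : ℝ) ≤ N := le_trans (by exact_mod_cast Finset.card_le_univ A) hι
        have hBN : (B.card : ℝ) ≤ N := le_trans (by exact_mod_cast Finset.card_le_univ B) hη
        -- The entropy of the larger side dominates the average of both, so the union bound factors
        -- into a sum over `A` and a sum over `B`.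
        have m1 : f A.card ≤ f (max (A.card : ℝ) B.card) :=
          mul_one_add_log_div_mono (by exact_mod_cast hA'.card_pos) (le_max_left _ _)
            (max_le hAN hBN)
        have m2 : f B.card ≤ f (max (A.card : ℝ) B.card) :=
          mul_one_add_log_div_mono (by exact_mod_cast hB'.card_pos) (le_max_right _ _)
            (max_le hAN hBN)
        nlinarith
    _ = (∑ A : Finset ι with A.Nonempty, Real.exp (-(κ / 4 * f A.card))) *
        ∑ B : Finset η with B.Nonempty, Real.exp (-(κ / 4 * f B.card)) := by
        rw [Finset.sum_mul_sum]
    _ ≤ Real.exp ((2 - κ / 4) * Real.log N) * Real.exp ((2 - κ / 4) * Real.log N) :=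
        mul_le_mul (sum_exp_neg_entropy_le hN hq hι) (sum_exp_neg_entropy_le hN hq hη)
          (Finset.sum_nonneg fun _ _ => (Real.exp_pos _).le) (Real.exp_pos _).le
    _ = _ := by rw [← Real.exp_add]; congr 1; ring

/-- Norm bound for a zero-one matrix with Poisson-type exponential moments. -/
theorem HasPoissonMGFBound.opNorm_tail [DecidableEq η] {p N D β : ℝ} {M : Ω → Matrix ι η ℝ}
    (h : HasPoissonMGFBound P p M) (hp : 0 ≤ p) (hN : 1 < N) (hD : Real.log N ≤ D)
    (hpN : p * N ≤ D) (hβ : 1 ≤ β) (hι : (Fintype.card ι : ℝ) ≤ N)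
    (hη : (Fintype.card η : ℝ) ≤ N) (h01 : ∀ᵐ ω ∂P, ∀ i j, M ω i j = 0 ∨ M ω i j = 1)
    (hrow : ∀ᵐ ω ∂P, ∀ i, ∑ j, M ω i j ≤ D) :
    P.real {ω | ¬ ‖M ω - Matrix.of fun _ _ => p‖ ≤ 50000 * β * √D} ≤
      3 * Real.exp (-((β + 3) * Real.log N)) := by
  have hN0 : 0 < N := by linarith
  have hlogN : 0 < Real.log N := Real.log_pos hN
  have hD0 : 0 < D := hlogN.trans_le hD
  set r := √D with hr_def
  have hr : 0 < r := Real.sqrt_pos.2 hD0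
  have hr2 : r ^ 2 = D := Real.sq_sqrt hD0.le
  have hpN' : p * N ≤ r ^ 2 := by rwa [hr2]
  -- Chosen so that `4 - κ / 2 = -(β + 3)` in the discrepancy tail. Likewise `t` gives `2 + 2 + 1 -
  -- t = -(β + 3)`: two nets and the quadratic cost.
  set κ := 2 * β + 14 with hκ_def
  set t := β + 8 with ht_def
  have hκ : 1 ≤ κ := by linarith
  have hlogle : Real.log N ≤ N := by linarith [Real.log_le_sub_one_of_pos hN0]
  obtain ⟨T, hTc, hT1, hT⟩ := exists_half_net_euclidean ι hι
  obtain ⟨T', hTc', hT1', hT'⟩ := exists_half_net_euclidean η hη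
  set light : EuclideanSpace ℝ ι → EuclideanSpace ℝ η → Set Ω := fun u v =>
    {ω | t * r ≤ ∑ i, ∑ j, (if |u i * v j| ≤ r / N then u i * v j * (M ω i j - p) else 0)}
    with hlight_def
  set bad1 : Set Ω := ⋃ u ∈ T, ⋃ v ∈ T', light u v with hbad1
  set bad2 : Set Ω := ⋃ j ∈ (Finset.univ : Finset η), {ω | κ * r ^ 2 ≤ ∑ i, M ω i j} with hbad2
  set bad3 : Set Ω := {ω | (∀ i j, M ω i j = 0 ∨ M ω i j = 1) ∧
    ¬ HasDiscrepancyBound N r κ (M ω)} with hbad3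
  set bad4 : Set Ω := {ω | ¬ ((∀ i j, M ω i j = 0 ∨ M ω i j = 1) ∧ ∀ i, ∑ j, M ω i j ≤ D)}
    with hbad4
  have p1 : P.real bad1 ≤ Real.exp (-((β + 3) * Real.log N)) := by
    calc P.real bad1 ≤ ∑ u ∈ T, ∑ v ∈ T', P.real (light u v) :=
          (measureReal_biUnion_finset_le _ _).trans
            (Finset.sum_le_sum fun u _ => measureReal_biUnion_finset_le _ _)
      _ ≤ ∑ u ∈ T, ∑ v ∈ T', Real.exp (N - t * N) :=
          Finset.sum_le_sum fun u hu => Finset.sum_le_sum fun v hv =>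
            h.light_tail hp hN0 hr hpN' (hT1 u hu) (hT1' v hv) t
      _ = T.card * (T'.card * Real.exp (N - t * N)) := by simp
      _ ≤ Real.exp (2 * N) * (Real.exp (2 * N) * Real.exp (N - t * N)) := by gcongr
      _ = Real.exp (-((β + 3) * N)) := by
          rw [← Real.exp_add, ← Real.exp_add, ht_def]; congr 1; ring
      _ ≤ _ := by
          refine Real.exp_le_exp.2 (neg_le_neg ?_)
          gcongr
  have p2 : P.real bad2 ≤ Real.exp (-((β + 3) * Real.log N)) := by
    calc P.real bad2 ≤ ∑ j : η, P.real {ω | κ * r ^ 2 ≤ ∑ i, M ω i j} :=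
          measureReal_biUnion_finset_le _ _
      _ ≤ ∑ _j : η, Real.exp (2 * r ^ 2 - κ * r ^ 2) :=
          Finset.sum_le_sum fun j _ => h.col_tail hp hpN' hι j _
      _ = Fintype.card η * Real.exp (2 * r ^ 2 - κ * r ^ 2) := by simp
      _ ≤ N * Real.exp (2 * r ^ 2 - κ * r ^ 2) := by gcongr
      _ = Real.exp (Real.log N + (2 * r ^ 2 - κ * r ^ 2)) := by
          rw [Real.exp_add, Real.exp_log hN0]
      _ ≤ _ := by
          refine Real.exp_le_exp.2 ?_
          rw [hr2, hκ_def]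
          -- The hypothesis `log N ≤ D` enters here: it pays for the union over columns even when `p
          -- * N` is small.
          nlinarith
  have p3 : P.real bad3 ≤ Real.exp (-((β + 3) * Real.log N)) := by
    refine (h.disc_tail_all hN.le hr hpN' (by linarith) hι hη).trans (le_of_eq ?_)
    rw [hκ_def]; congr 1; ring
  have p4 : P.real bad4 = 0 := by
    rw [measureReal_eq_zero_iff]
    exact h01.and hrow
  have hsub : {ω | ¬ ‖M ω - Matrix.of fun _ _ => p‖ ≤ 50000 * β * r} ⊆
      ((bad1 ∪ bad2) ∪ bad3) ∪ bad4 := by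
    intro ω hω
    by_contra hgood
    simp only [Set.mem_union, not_or] at hgood
    obtain ⟨⟨⟨g1, g2⟩, g3⟩, g4⟩ := hgood
    refine hω ?_
    simp only [hbad4, Set.mem_ofPred_eq, not_not] at g4
    obtain ⟨g01, grow⟩ := g4
    simp only [hbad3, Set.mem_ofPred_eq, not_and, not_not] at g3
    simp only [hbad2, Set.mem_iUnion, Set.mem_ofPred_eq, not_exists, not_le] at g2
    simp only [hbad1, hlight_def, Set.mem_iUnion, Set.mem_ofPred_eq, not_exists, not_le] at g1
    have hM : ∀ i j, 0 ≤ M ω i j := fun i j => by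
      rcases g01 i j with e | e <;> rw [e]
      exact zero_le_one
    have hB : 0 ≤ t * r + 768 * κ * r + r := by positivity
    refine (Matrix.l2_opNorm_le_of_net hT hT' _ hB fun u hu v hv => ?_).trans ?_
    · exact bilinear_le_light_add_heavy hp hN0 hr hpN' hκ hM hι hη
        (fun i => (grow i).trans (by rw [hr2]; exact le_mul_of_one_le_left hD0.le hκ))
        (fun j => (g2 j (Finset.mem_univ j)).le) (g3 g01) (hT1 u hu) (hT1' v hv)
        (g1 u hu v hv).le
    -- The left coefficient is `6148 * β + 43044`, at most `49192 * β` because `1 ≤ β`.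
    · have : (4 * (t + 768 * κ + 1)) * r ≤ (50000 * β) * r :=
        mul_le_mul_of_nonneg_right (by linarith) hr.le
      linarith
  calc _ ≤ P.real (((bad1 ∪ bad2) ∪ bad3) ∪ bad4) := measureReal_mono hsub
    _ ≤ P.real bad1 + P.real bad2 + P.real bad3 + P.real bad4 := by
        refine (measureReal_union_le _ _).trans (add_le_add_left ?_ _)
        refine (measureReal_union_le _ _).trans (add_le_add_left ?_ _)
        exact measureReal_union_le _ _
    _ ≤ _ := by linarith

end Core

/-! ### The uniform law on vectors with `d` ones -/

section ZeroOneVectors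

theorem integral_uniformOn_finset {X : Type*} [MeasurableSpace X] [MeasurableSingletonClass X]
    (F : Finset X) (f : X → ℝ) :
    ∫ x, f x ∂(uniformOn (F : Set X)) = (F.card : ℝ)⁻¹ * ∑ x ∈ F, f x := by
  rw [uniformOn, ProbabilityTheory.cond, integral_smul_measure, setIntegral_finset,
    Measure.count_apply_finset]
  · simp [Measure.real]
  · rw [← (F : Set X).biUnion_of_singleton]
    simp [integrableOn_finset_iUnion]

/-- The indicator vector of a finite set. -/
noncomputable def indicatorVector {n : ℕ} (S : Finset (Fin n)) : Fin n → ℝ :=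
  fun j => if j ∈ S then 1 else 0

theorem indicatorVector_injective {n : ℕ} :
    Function.Injective (indicatorVector : Finset (Fin n) → Fin n → ℝ) := by
  intro S T h
  ext j
  have := congrFun h j
  unfold indicatorVector at this
  by_cases h1 : j ∈ S <;> by_cases h2 : j ∈ T <;> simp_all

theorem zeroOneVectors_eq_image (n d : ℕ) :
    zeroOneVectors n d = ((Finset.powersetCard d Finset.univ).map
      ⟨indicatorVector, indicatorVector_injective⟩ : Finset (Fin n → ℝ)) := by
  classical
  ext v
  simp only [zeroOneVectors, Set.mem_ofPred_eq, Finset.coe_map, Function.Embedding.coeFn_mk,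
    Set.mem_image, Finset.mem_coe, Finset.mem_powersetCard, Finset.subset_univ, true_and]
  constructor
  · rintro ⟨h1, h2⟩
    refine ⟨Finset.univ.filter fun j => v j = 1, ?_, ?_⟩
    · rw [← h2, Set.ncard_eq_toFinset_card']
      congr 1
      ext j
      simp
    · ext j
      rcases h1 j with h | h <;> simp [indicatorVector, h]
  · rintro ⟨S, hS, rfl⟩
    refine ⟨fun j => ?_, ?_⟩
    · by_cases h : j ∈ S <;> simp [indicatorVector, h]
    · rw [← hS, Set.ncard_eq_toFinset_card']
      congr 1
      ext j
      by_cases h : j ∈ S <;> simp [indicatorVector, h]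

theorem finite_zeroOneVectors (n d : ℕ) : (zeroOneVectors n d).Finite := by
  rw [zeroOneVectors_eq_image]
  exact Finset.finite_toSet _

theorem sum_eq_of_mem_zeroOneVectors {n d : ℕ} {v : Fin n → ℝ} (hv : v ∈ zeroOneVectors n d) :
    ∑ j, v j = d := by
  rw [zeroOneVectors_eq_image] at hv
  obtain ⟨S, hS, rfl⟩ := Finset.mem_map.1 (Finset.mem_coe.1 hv)
  simp [indicatorVector, (Finset.mem_powersetCard.1 hS).2]

theorem integral_uniformOn_zeroOneVectors (n d : ℕ) (f : (Fin n → ℝ) → ℝ) :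
    ∫ x, f x ∂(uniformOn (zeroOneVectors n d)) =
      ((n.choose d : ℕ) : ℝ)⁻¹ * ∑ S ∈ Finset.powersetCard d Finset.univ, f (indicatorVector S) := by
  rw [zeroOneVectors_eq_image, integral_uniformOn_finset, Finset.card_map,
    Finset.card_powersetCard, Finset.sum_map, Finset.card_univ, Fintype.card_fin]
  rfl

theorem integral_exp_uniformOn_zeroOneVectors_le {n d : ℕ} (hn : 0 < n) (hd : d ≤ n)
    (b : Fin n → ℝ) :
    ∫ x, Real.exp (∑ j, b j * x j) ∂(uniformOn (zeroOneVectors n d)) ≤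
      Real.exp (d / n * ∑ j, (Real.exp (b j) - 1)) := by
  have : Nonempty (Fin n) := ⟨⟨0, hn⟩⟩
  have hc : (0 : ℝ) < n.choose d := by exact_mod_cast Nat.choose_pos hd
  rw [integral_uniformOn_zeroOneVectors, inv_mul_le_iff₀ hc]
  have h := sum_powersetCard_prod_le_exp (x := fun j : Fin n => Real.exp (b j))
    (fun j => (Real.exp_pos _).le) d
  rw [Fintype.card_fin] at h
  refine le_trans (le_of_eq (Finset.sum_congr rfl fun S _ => ?_)) h
  rw [← Real.exp_sum]
  simp [indicatorVector]

theorem integral_apply_uniformOn_zeroOneVectors {n d : ℕ} (hd : d ≤ n) (j : Fin n) :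
    ∫ x, x j ∂(uniformOn (zeroOneVectors n d)) = d / n := by
  obtain ⟨n, rfl⟩ : ∃ k, n = k + 1 := ⟨n - 1, by have := j.pos; omega⟩
  have hc : (0 : ℝ) < (n + 1).choose d := by exact_mod_cast Nat.choose_pos hd
  have h1 : Finset.powersetCard d (Finset.univ.erase j) =
      (Finset.powersetCard d Finset.univ).filter (fun S => j ∉ S) := by
    ext S
    simp [Finset.mem_powersetCard, Finset.subset_erase, and_comm]
  have h2 : ∑ S ∈ Finset.powersetCard d Finset.univ, indicatorVector S j =
      (n + 1).choose d - n.choose d := by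
    have h3 : ∀ S : Finset (Fin (n + 1)), indicatorVector S j = 1 - if j ∉ S then 1 else 0 := by
      intro S
      by_cases h : j ∈ S <;> simp [indicatorVector, h]
    simp_rw [h3]
    rw [Finset.sum_sub_distrib, ← Finset.sum_filter, ← h1]
    simp
  have h4 : (n.choose d : ℝ) * (n + 1) = (n + 1).choose d * ((n + 1 : ℝ) - d) := by
    have h := Nat.choose_mul_succ_eq n d
    have h' : ((n + 1 - d : ℕ) : ℝ) = (n + 1 : ℝ) - d := by rw [Nat.cast_sub hd]; push_cast; ring
    rw [← h']
    exact_mod_cast h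
  rw [integral_uniformOn_zeroOneVectors, h2, inv_mul_eq_div, div_eq_div_iff hc.ne' (by positivity)]
  push_cast
  linarith

/-- Complementation is an involution, so it preserves counting measure, and it exchanges the two
supports. -/
theorem map_one_sub_uniformOn_zeroOneVectors {n d : ℕ} (hd : d ≤ n) :
    (uniformOn (zeroOneVectors n d)).map (fun x => 1 - x) = uniformOn (zeroOneVectors n (n - d)) := by
  have hinv : Function.Involutive fun x : Fin n → ℝ => 1 - x := fun x => sub_sub_cancel 1 x
  have hmeas : Measurable fun x : Fin n → ℝ => 1 - x := by fun_prop
  have hcount : ∀ t : Set (Fin n → ℝ),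
      Measure.count ((fun x : Fin n → ℝ => 1 - x) ⁻¹' t) = Measure.count t := fun t => by
    rw [← hinv.image_eq_preimage_symm, Measure.count_injective_image hinv.injective]
  have hpre : (fun x : Fin n → ℝ => 1 - x) ⁻¹' zeroOneVectors n (n - d) = zeroOneVectors n d := by
    have key : ∀ k l : ℕ, k + l = n → ∀ x ∈ zeroOneVectors n k, 1 - x ∈ zeroOneVectors n l := by
      intro k l hkl x hx
      refine ⟨fun j => ?_, ?_⟩
      · rcases hx.1 j with h | h <;> simp [h]
      · have e : {j | (1 - x) j = 1} = {j | x j = 1}ᶜ := by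
          ext j
          rcases hx.1 j with h | h <;> simp [h]
        have h2 := hx.2
        rw [e, Set.ncard_compl, h2, Nat.card_fin]
        omega
    ext x
    constructor
    · intro hx
      have := key (n - d) d (by omega) _ hx
      rwa [sub_sub_cancel] at this
    · exact key d (n - d) (by omega) x
  ext t ht
  rw [Measure.map_apply hmeas ht, uniformOn, uniformOn,
    cond_apply (finite_zeroOneVectors n d).measurableSet,
    cond_apply (finite_zeroOneVectors n (n - d)).measurableSet, ← hpre, ← Set.preimage_inter,
    hcount, hcount]

end ZeroOneVectors

/-! ### From independent rows to the Poisson comparison -/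

section Rows

variable {Ω : Type*} [MeasurableSpace Ω] {P : Measure Ω} {n d : ℕ}

theorem ae_mem_zeroOneVectors {X : Ω → Fin n → ℝ}
    (hX : HasLaw X (uniformOn (zeroOneVectors n d)) P) : ∀ᵐ ω ∂P, X ω ∈ zeroOneVectors n d := by
  have hm := (finite_zeroOneVectors n d).measurableSet
  rw [hX.ae_iff (p := fun x => x ∈ zeroOneVectors n d) hm.mem]
  exact ae_cond_mem hm

theorem hasPoissonMGFBound_of_rows [IsProbabilityMeasure P] {ι : Type*} [Fintype ι] (hn : 0 < n) (hd : d ≤ n)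
    {M : Ω → Matrix ι (Fin n) ℝ}
    (hlaw : ∀ i, HasLaw (fun ω => M ω i) (uniformOn (zeroOneVectors n d)) P)
    (hindep : iIndepFun (fun i ω => M ω i) P) : HasPoissonMGFBound P (d / n) M := by
  intro b
  set φ : ι → (Fin n → ℝ) → ℝ := fun i x => Real.exp (∑ j, b i j * x j) with hφ
  have hφm : ∀ i, Measurable (φ i) := fun i => by fun_prop
  have hXm : ∀ i, AEMeasurable (fun ω => φ i (M ω i)) P := fun i =>
    (hφm i).comp_aemeasurable (hlaw i).aemeasurable
  have hprod : ∀ ω, Real.exp (∑ i, ∑ j, b i j * M ω i j) = ∏ i, φ i (M ω i) := fun ω => by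
    rw [Real.exp_sum]
  simp_rw [hprod]
  refine ⟨Integrable.of_bound (C := ∏ i, Real.exp (∑ j, |b i j|))
    (Finset.aemeasurable_fun_prod _ fun i _ => hXm i).aestronglyMeasurable ?_, ?_⟩
  · filter_upwards [ae_all_iff.2 fun i => ae_mem_zeroOneVectors (hlaw i)] with ω hω
    rw [Real.norm_of_nonneg (Finset.prod_nonneg fun i _ => (Real.exp_pos _).le)]
    refine Finset.prod_le_prod (fun i _ => (Real.exp_pos _).le) fun i _ =>
      Real.exp_le_exp.2 (Finset.sum_le_sum fun j _ => ?_)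
    rcases (hω i).1 j with h | h <;> rw [h]
    · simp
    · simpa using le_abs_self (b i j)
  · have hind := hindep.comp φ hφm
    have h := hind.integral_prod_eq_prod_integral fun i => (hXm i).aestronglyMeasurable
    simp only [Finset.prod_apply, Function.comp_apply] at h
    rw [h, Finset.mul_sum, Real.exp_sum]
    refine Finset.prod_le_prod (fun i _ => integral_nonneg fun ω => (Real.exp_pos _).le)
      fun i _ => ?_
    have e := (hlaw i).integral_comp (f := φ i) (hφm i).aestronglyMeasurable
    simp only [Function.comp_apply] at e
    rw [e]
    exact integral_exp_uniformOn_zeroOneVectors_le hn hd (b i)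

end Rows

/-! ### Norm bounds for the random matrix -/

namespace IsRandomCombinatorialMatrix

variable {Ω : Type*} [MeasurableSpace Ω] {P : Measure Ω} {m n d : ℕ}
  {M : Ω → Matrix (Fin m) (Fin n) ℝ}

theorem expectedMatrix_eq (h : IsRandomCombinatorialMatrix P d M) (hd : d ≤ n) :
    expectedMatrix P M = Matrix.of fun _ _ => (d : ℝ) / n := by
  ext i j
  have e := (h.row_law i).integral_comp (f := fun x => x j)
    (measurable_pi_apply j).aestronglyMeasurable
  simp only [Function.comp_apply] at e
  simp only [expectedMatrix, Matrix.of_apply]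
  rw [e, integral_apply_uniformOn_zeroOneVectors hd]

theorem one_sub (h : IsRandomCombinatorialMatrix P d M) (hd : d ≤ n) :
    IsRandomCombinatorialMatrix P (n - d) fun ω => Matrix.of fun i j => 1 - M ω i j := by
  have hmeas : Measurable fun x : Fin n → ℝ => 1 - x := by fun_prop
  refine ⟨fun i => ⟨hmeas.comp_aemeasurable (h.row_law i).aemeasurable, ?_⟩,
    h.row_indep.comp (fun _ x => 1 - x) fun _ => hmeas⟩
  have e := AEMeasurable.map_map_of_aemeasurable (μ := P) (f := fun ω => M ω i)
    (g := fun x : Fin n → ℝ => 1 - x) hmeas.aemeasurable (h.row_law i).aemeasurable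
  rw [(h.row_law i).map_eq, map_one_sub_uniformOn_zeroOneVectors hd] at e
  exact e.symm

theorem ae_rows_mem (h : IsRandomCombinatorialMatrix P d M) :
    ∀ᵐ ω ∂P, ∀ i, M ω i ∈ zeroOneVectors n d :=
  ae_all_iff.2 fun i => ae_mem_zeroOneVectors (h.row_law i)

theorem block_tail [IsProbabilityMeasure P] (h : IsRandomCombinatorialMatrix P d M) (hn : 2 ≤ n) (hd : d ≤ n) {β : ℝ}
    (hβ : 1 ≤ β) {ι : Type*} [Fintype ι] {f : ι → Fin m} (hf : Function.Injective f)
    (hι : Fintype.card ι ≤ n) :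
    P.real {ω | ¬ ‖(M ω - Matrix.of fun _ _ => (d : ℝ) / n).submatrix f id‖ ≤
      50000 * β * √(d + Real.log n)} ≤ 3 * Real.exp (-((β + 3) * Real.log n)) := by
  have hn1 : (1 : ℝ) < n := by exact_mod_cast hn
  have hlog : 0 < Real.log n := Real.log_pos hn1
  have hpois : HasPoissonMGFBound P ((d : ℝ) / n) fun ω => (M ω).submatrix f id :=
    hasPoissonMGFBound_of_rows (by omega) hd (fun i => h.row_law (f i)) (h.row_indep.precomp hf)
  refine hpois.opNorm_tail (D := d + Real.log n) (by positivity) hn1 ?_ ?_ hβ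
    (by exact_mod_cast hι) (by simp) ?_ ?_
  · linarith [Nat.cast_nonneg (α := ℝ) d]
  · rw [div_mul_cancel₀ _ (by positivity)]
    linarith
  · filter_upwards [h.ae_rows_mem] with ω hω i j using (hω (f i)).1 j
  · filter_upwards [h.ae_rows_mem] with ω hω i
    have := sum_eq_of_mem_zeroOneVectors (hω (f i))
    simp only [Matrix.submatrix_apply, id_eq]
    linarith

theorem opNorm_tail [IsProbabilityMeasure P] (h : IsRandomCombinatorialMatrix P d M) (hn : 2 ≤ n) (hd : d ≤ n) {β : ℝ}
    (hβ : 1 ≤ β) {k : ℕ} (hk : m ≤ n * k) :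
    P.real {ω | ¬ ‖M ω - Matrix.of fun _ _ => (d : ℝ) / n‖ ≤
      √k * (50000 * β * √(d + Real.log n))} ≤ k * (3 * Real.exp (-((β + 3) * Real.log n))) := by
  -- Consecutive runs of `n` rows; inside a run the residue modulo `n` determines the row.
  let f : Fin m → Fin k := fun i => ⟨i / n, Nat.div_lt_of_lt_mul (i.2.trans_le hk)⟩
  have hcard : ∀ l, Fintype.card {i // f i = l} ≤ n := by
    intro l
    rw [← Fintype.card_fin n]
    refine Fintype.card_le_of_injective (fun i => ⟨i.1 % n, Nat.mod_lt _ (by omega)⟩) ?_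
    rintro ⟨i, hi⟩ ⟨j, hj⟩ hij
    have h1 : (i : ℕ) / n = j / n := by
      have := hi.trans hj.symm
      simpa [f] using this
    have h2 : (i : ℕ) % n = j % n := by simpa using hij
    have h3 : (i : ℕ) = j := by rw [← Nat.div_add_mod i n, h1, h2, Nat.div_add_mod]
    exact Subtype.ext (Fin.ext h3)
  have hsub : {ω | ¬ ‖M ω - Matrix.of fun _ _ => (d : ℝ) / n‖ ≤
      √k * (50000 * β * √(d + Real.log n))} ⊆
      ⋃ l ∈ (Finset.univ : Finset (Fin k)),
        {ω | ¬ ‖(M ω - Matrix.of fun _ _ => (d : ℝ) / n).submatrix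
          (Subtype.val : {i // f i = l} → Fin m) id‖ ≤ 50000 * β * √(d + Real.log n)} := by
    intro ω hω
    by_contra hgood
    simp only [Set.mem_iUnion, Set.mem_ofPred_eq, not_exists, not_not] at hgood
    exact hω (Matrix.l2_opNorm_le_of_row_blocks f _ (by positivity)
      fun l => hgood l (Finset.mem_univ l))
  refine (measureReal_mono hsub (measure_ne_top _ _)).trans
    ((measureReal_biUnion_finset_le _ _).trans ?_)
  refine (Finset.sum_le_sum fun l _ =>
    h.block_tail hn hd hβ Subtype.val_injective (hcard l)).trans (le_of_eq ?_)
  simp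

theorem opNorm_tail_min [IsProbabilityMeasure P] (h : IsRandomCombinatorialMatrix P d M) (hn : 2 ≤ n) (hd : d ≤ n) {β : ℝ}
    (hβ : 1 ≤ β) {k : ℕ} (hk : m ≤ n * k) :
    P.real {ω | ¬ ‖M ω - expectedMatrix P M‖ ≤
      √k * (50000 * β * √(min (d : ℝ) (n - d) + Real.log n))} ≤
      k * (3 * Real.exp (-((β + 3) * Real.log n))) := by
  rw [h.expectedMatrix_eq hd]
  rcases le_total (d : ℝ) (n - d) with hle | hle
  · rw [min_eq_left hle]
    exact h.opNorm_tail hn hd hβ hk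
  · rw [min_eq_right hle, ← Nat.cast_sub hd]
    refine le_trans (le_of_eq ?_) ((h.one_sub hd).opNorm_tail hn (Nat.sub_le n d) hβ hk)
    congr 1
    ext ω
    have hn0 : (n : ℝ) ≠ 0 := by positivity
    have e : (Matrix.of fun i j => 1 - M ω i j) - (Matrix.of fun _ _ => ((n - d : ℕ) : ℝ) / n) =
        -(M ω - Matrix.of fun _ _ => (d : ℝ) / n) := by
      ext i j
      simp only [Matrix.sub_apply, Matrix.of_apply, Matrix.neg_apply, Nat.cast_sub hd]
      field_simp
      ring
    simp only [Set.mem_ofPred_eq]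
    rw [e, norm_neg]

theorem ae_le_opNorm_sq (h : IsRandomCombinatorialMatrix P d M) (hn : 1 ≤ n) (hd : d ≤ n) :
    ∀ᵐ ω ∂P, (m : ℝ) * (d - d ^ 2 / n) ≤ n * ‖M ω - expectedMatrix P M‖ ^ 2 := by
  rw [h.expectedMatrix_eq hd]
  filter_upwards [h.ae_rows_mem] with ω hω
  have hn0 : (n : ℝ) ≠ 0 := by positivity
  have key := Matrix.sum_sq_le_card_mul_l2_opNorm_sq (M ω - Matrix.of fun _ _ => (d : ℝ) / n)
  rw [Fintype.card_fin] at key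
  refine le_trans (le_of_eq ?_) key
  have hrow : ∀ i, ∑ j, (M ω - Matrix.of fun _ _ => (d : ℝ) / n : Matrix _ _ ℝ) i j ^ 2 = d - (d : ℝ) ^ 2 / n := by
    intro i
    have e : ∀ j, (M ω - Matrix.of fun _ _ => (d : ℝ) / n : Matrix _ _ ℝ) i j ^ 2 =
        M ω i j * (1 - 2 * (d / n)) + (d / n : ℝ) ^ 2 := by
      intro j
      simp only [Matrix.sub_apply, Matrix.of_apply]
      rcases (hω i).1 j with h | h <;> rw [h] <;> ring
    simp_rw [e]
    rw [Finset.sum_add_distrib, ← Finset.sum_mul, sum_eq_of_mem_zeroOneVectors (hω i)]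
    simp only [Finset.sum_const, Finset.card_univ, Fintype.card_fin, nsmul_eq_mul]
    field_simp
    ring
  simp_rw [hrow, Finset.sum_const, Finset.card_univ, Fintype.card_fin, nsmul_eq_mul]

end IsRandomCombinatorialMatrix

/-! ### Numerical bounds and conclusion -/

section NumericalBounds

theorem three_mul_exp_le_two_mul_rpow {n β : ℝ} (hn : 2 ≤ n) :
    3 * Real.exp (-((β + 3) * Real.log n)) ≤ 2 * n ^ (-β) := by
  have hn0 : 0 < n := by linarith
  have e : Real.exp (-((β + 3) * Real.log n)) = n ^ (-β) * n⁻¹ ^ 3 := by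
    rw [Real.rpow_def_of_pos hn0, ← Real.exp_log (inv_pos.2 hn0), ← Real.exp_nat_mul,
      ← Real.exp_add, Real.log_inv]
    congr 1; push_cast; ring
  have h2 : n⁻¹ ^ 3 ≤ 2 / 3 := by
    have h1 : n⁻¹ ≤ 2⁻¹ := inv_anti₀ two_pos hn
    calc n⁻¹ ^ 3 ≤ (2⁻¹ : ℝ) ^ 3 := pow_le_pow_left₀ (inv_pos.2 hn0).le h1 3
      _ ≤ 2 / 3 := by norm_num
  rw [e]
  have := mul_le_mul_of_nonneg_left h2 (Real.rpow_nonneg hn0.le (-β))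
  linarith

theorem one_sub_le_measureReal_of_compl_le {Ω : Type*} [MeasurableSpace Ω] {P : Measure Ω}
    [IsProbabilityMeasure P] {p : Ω → Prop} {ε : ℝ} (h : P.real {ω | ¬ p ω} ≤ ε) :
    1 - ε ≤ P.real {ω | p ω} := by
  have h1 := measureReal_union_le (μ := P) {ω | p ω} {ω | ¬ p ω}
  have h2 : {ω | p ω} ∪ {ω | ¬ p ω} = Set.univ := Set.union_compl_self _
  rw [h2, probReal_univ] at h1
  linarith

end NumericalBounds

theorem theorem4p8 :
    (∃ C : ℝ, 0 < C ∧
      ∀ (m n d : ℕ) (γ β : ℝ), 1 ≤ m → 1 ≤ n → 4 ≤ γ → 1 ≤ β → 1 ≤ d → d ≤ n →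
      ∀ (Ω : Type*) [MeasurableSpace Ω] (P : Measure Ω) [IsProbabilityMeasure P]
        (M : Ω → Matrix (Fin m) (Fin n) ℝ), IsRandomCombinatorialMatrix P d M →
      ∀ k : ℕ, k = ⌈(m : ℝ) / (n : ℝ)⌉₊ →
        1 - (k : ℝ) * ((2 : ℝ) ^ γ * (n : ℝ) ^ (1 - γ) + 2 * (n : ℝ) ^ (-β)) ≤
          P.real {ω | ‖M ω - expectedMatrix P M‖ ≤
            C * β * √(k : ℝ) * √(min (d : ℝ) ((n : ℝ) - (d : ℝ)) + γ * Real.log n)}) ∧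
    (∃ c : ℝ, 0 < c ∧
      ∀ (m n d : ℕ) (γ : ℝ), 1 ≤ n → n ≤ m → 4 ≤ γ → 1 ≤ d →
        Real.log n ≤ (d : ℝ) → (d : ℝ) ≤ (n : ℝ) / 2 →
      ∀ (Ω : Type*) [MeasurableSpace Ω] (P : Measure Ω) [IsProbabilityMeasure P]
        (M : Ω → Matrix (Fin m) (Fin n) ℝ), IsRandomCombinatorialMatrix P d M →
      ∀ k : ℕ, k = ⌈(m : ℝ) / (n : ℝ)⌉₊ →
        ∀ᵐ ω ∂P, c / √γ * √(k : ℝ) * √(min (d : ℝ) ((n : ℝ) - (d : ℝ)) + γ * Real.log n) ≤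
          ‖M ω - expectedMatrix P M‖) := by
  constructor
  · refine ⟨50000, by norm_num, ?_⟩
    intro m n d γ β hm hn hγ hβ _ hdn Ω _ P _ M hM k hk
    have hn0 : (0 : ℝ) < n := by exact_mod_cast hn
    have hm0 : (0 : ℝ) < m := by exact_mod_cast hm
    have hk1 : (1 : ℝ) ≤ k := by
      rw [hk]
      exact_mod_cast Nat.ceil_pos.2 (div_pos hm0 hn0)
    -- For `n = 1` the claimed lower bound for the probability is negative; the main argument needs
    -- `log n > 0`.
    rcases hn.eq_or_lt with rfl | hn2
    · refine le_trans ?_ measureReal_nonneg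
      have h2 : (0 : ℝ) < 2 ^ γ := Real.rpow_pos_of_pos two_pos γ
      simp only [Nat.cast_one, Real.one_rpow, mul_one]
      have := mul_le_mul hk1 (show (1 : ℝ) ≤ 2 ^ γ + 2 by linarith) zero_le_one (by linarith)
      linarith
    have hn2' : (2 : ℝ) ≤ n := by exact_mod_cast hn2
    have hmk : m ≤ n * k := by
      have h := Nat.le_ceil ((m : ℝ) / n)
      rw [← hk, div_le_iff₀ hn0, mul_comm] at h
      exact_mod_cast h
    have hlog : 0 ≤ Real.log n := Real.log_nonneg (by linarith)
    have htail := hM.opNorm_tail_min hn2 hdn hβ hmk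
    -- The term `2 * n ^ (-β)` alone covers the failure probability, and the norm bound already
    -- holds with `log n` in place of `γ * log n`.
    have hfail : (k : ℝ) * (3 * Real.exp (-((β + 3) * Real.log n))) ≤
        k * ((2 : ℝ) ^ γ * (n : ℝ) ^ (1 - γ) + 2 * (n : ℝ) ^ (-β)) := by
      have h1 := three_mul_exp_le_two_mul_rpow (β := β) hn2'
      have h2 : 0 ≤ (2 : ℝ) ^ γ * (n : ℝ) ^ (1 - γ) := by positivity
      gcongr
      linarith
    refine one_sub_le_measureReal_of_compl_le (le_trans (measureReal_mono ?_ (measure_ne_top _ _))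
      (htail.trans hfail))
    intro ω hω hle
    refine hω (hle.trans ?_)
    have hmono : √(min (d : ℝ) (n - d) + Real.log n) ≤ √(min (d : ℝ) (n - d) + γ * Real.log n) := by
      refine Real.sqrt_le_sqrt ?_
      have := le_mul_of_one_le_left hlog (by linarith : 1 ≤ γ)
      linarith
    calc √k * (50000 * β * √(min (d : ℝ) (n - d) + Real.log n)) ≤
          √k * (50000 * β * √(min (d : ℝ) (n - d) + γ * Real.log n)) := by gcongr
      _ = _ := by ring
  · refine ⟨1 / 4, by norm_num, ?_⟩
    intro m n d γ hn hnm hγ hd hlogd hdn Ω _ P _ M hM k hk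
    have hn0 : (0 : ℝ) < n := by exact_mod_cast hn
    have hnm' : (n : ℝ) ≤ m := by exact_mod_cast hnm
    have hd0 : (0 : ℝ) < d := by exact_mod_cast hd
    have hγ0 : 0 < γ := by linarith
    have hdn' : d ≤ n := by
      have : (d : ℝ) ≤ n := by linarith
      exact_mod_cast this
    have hlog : 0 ≤ Real.log n := Real.log_nonneg (by exact_mod_cast hn)
    -- Rounding up at most doubles `m / n`, because `m ≥ n`.
    have hkle : (k : ℝ) * n ≤ 2 * m := by
      have h := Nat.ceil_lt_add_one (div_nonneg (hn0.le.trans hnm') hn0.le)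
      rw [← hk] at h
      have h2 : (k : ℝ) * n ≤ (m / n + 1) * n := by gcongr
      rw [add_mul, div_mul_cancel₀ _ hn0.ne'] at h2
      linarith
    filter_upwards [hM.ae_le_opNorm_sq hn hdn'] with ω hω
    refine le_of_sq_le_sq ?_ (norm_nonneg _)
    rw [min_eq_left (by linarith), mul_pow, mul_pow, div_pow, Real.sq_sqrt hγ0.le,
      Real.sq_sqrt (Nat.cast_nonneg k), Real.sq_sqrt (by positivity)]
    -- Both `d` and `γ * log n` are at most `γ * d`; this is where the loss `1 / √γ` arises.
    have h1 : (d : ℝ) + γ * Real.log n ≤ γ * (2 * d) := by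
      have := mul_le_mul_of_nonneg_left hlogd hγ0.le
      nlinarith
    have h2 : (d : ℝ) / 2 ≤ d - d ^ 2 / n := by
      have : (d : ℝ) ^ 2 / n ≤ d / 2 := by
        rw [div_le_iff₀ hn0]
        nlinarith
      linarith
    have h3 : (m : ℝ) * (d / 2) ≤ n * ‖M ω - expectedMatrix P M‖ ^ 2 :=
      (mul_le_mul_of_nonneg_left h2 (Nat.cast_nonneg m)).trans hω
    calc (1 / 4 : ℝ) ^ 2 / γ * k * (d + γ * Real.log n) ≤ (1 / 4) ^ 2 / γ * k * (γ * (2 * d)) := by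
          gcongr
      _ = ((k : ℝ) * n) * d / (8 * n) := by field_simp; ring
      _ ≤ (2 * (m : ℝ)) * d / (8 * n) := by gcongr
      _ = ((m : ℝ) * (d / 2)) / n / 2 := by field_simp; ring
      _ ≤ (n * ‖M ω - expectedMatrix P M‖ ^ 2) / n / 2 := by gcongr
      _ = ‖M ω - expectedMatrix P M‖ ^ 2 / 2 := by field_simp
      _ ≤ ‖M ω - expectedMatrix P M‖ ^ 2 := by linarith [sq_nonneg ‖M ω - expectedMatrix P M‖]
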